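/- For a finitely supported sequence $\gamma=(\gamma_1,\gamma_2,\dots)$ of nonnegative integers put $|\gamma|=\sum_i\gamma_i$, and let $l(\gamma)$ be the least $l\ge 0$ such that $\gamma_k=0$ for all $k>l$. Let $\varepsilon_i$ be the sequence with $1$ in position $i$ and zeros elsewhere. Write $\alpha\vdash n$ if $|\alpha|=n$ and $\alpha_i\ge\alpha_{i+1}$ for all $i$. For $\alpha\vdash n$ let $\zeta^\alpha$ be the irreducible (complex) character of the symmetric group $S_n$ corresponding to $\alpha$, that is, the character of the Specht module $S^\alpha$; and for a finitely supported sequence $\beta$ of nonnegative integers with $|\beta|=n$ put $\zeta^\alpha_\beta=\zeta^\alpha(\sigma_\beta)$, where $\sigma_\beta\in S_n$ is the product of the cycles on the consecutive blocks of $\{1,\dots,n\}$ of sizes $\beta_1,\beta_2,\dots$: its $j$-th factor is the cycle $(s_{j1},s_{j2},\dots,s_{j\beta_j})$ with $s_{ji}=i+\sum_{k<j}\beta_k$ (the identity if $\beta_j=0$). **Theorem.** Let $n\ge 1$ be an integer. For every $\alpha\vdash n$ and every finitely supported sequence $\beta$ of nonnegative integers with $|\beta|=n-1$, $$\sum_{\substack{1\le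 i\le l(\alpha)\\ \alpha_i>\alpha_{i+1}}}(\alpha_i-i)\,\zeta^{\alpha-\varepsilon_i}_\beta=\sum_{j=1}^{l(\beta)}\beta_j\,\zeta^\alpha_{\beta+\varepsilon_j}.$$ -/

import Mathlib

namespace SymChar

/-!
Sequences of nonnegative integers that are eventually zero are elements of `ℕ →₀ ℕ`. Positions are
counted from `0`: the value `γ i` is the entry that is usually written `γ_{i+1}`. The sum `|γ|` of
the entries is `γ.degree`, and `Finsupp.single i 1` is the sequence with a single `1` in the
`(i+1)`-st position. The symmetric group of degree `n` is `Equiv.Perm (Fin n)`.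
-/

/-- The length of `γ`: the least `l` such that all entries after the first `l` ones vanish. -/
noncomputable def len (γ : ℕ →₀ ℕ) : ℕ :=
  sInf {l : ℕ | ∀ k, l ≤ k → γ k = 0}

/-- `α` is a partition of `n`: its entries are nonincreasing and add up to `n`. -/
def IsPartition (α : ℕ →₀ ℕ) (n : ℕ) : Prop :=
  α.degree = n ∧ ∀ i, α (i + 1) ≤ α i

/-- The number of entries in the rows before row `j`, that is, the sum of the first `j` entries. -/
def rowStart (β : ℕ →₀ ℕ) (j : ℕ) : ℕ := ∑ k ∈ Finset.range j, β k

theorem rowStart_add_lt (β : ℕ →₀ ℕ) (j : ℕ) (i : ℕ) (hi : i < β j) :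
    rowStart β j + i < β.degree := by
  have h1 : rowStart β j + β j ≤ β.degree := by
    rw [rowStart, ← Finset.sum_range_succ, Finsupp.degree_apply]
    exact Finset.sum_le_sum_of_ne_zero fun x _ hx => Finsupp.mem_support_iff.mpr hx
  omega

/-- The cycle `(s_{j1}, s_{j2}, …, s_{jβ_j})` on the `j`-th of the consecutive blocks of sizes
`β_1, β_2, …` of `{1, …, |β|}`. It is the identity if `β_j` is `0` or `1`. -/
noncomputable def blockCycle (β : ℕ →₀ ℕ) (j : ℕ) : Equiv.Perm (Fin β.degree) :=
  ((List.finRange (β j)).map fun i : Fin (β j) =>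
    (⟨rowStart β j + i, rowStart_add_lt β j i i.2⟩ : Fin β.degree)).formPerm

/-- The permutation `σ_β` of degree `|β|`: the product of the (disjoint) cycles on the consecutive
blocks of sizes `β_1, β_2, …`. -/
noncomputable def stdPerm (β : ℕ →₀ ℕ) : Equiv.Perm (Fin β.degree) :=
  ((List.range (len β)).map (blockCycle β)).prod

/-- An `α`-tabloid: a sequence of pairwise disjoint subsets of an `n`-element set, of sizes
`α_1, α_2, …` (adding up to `n`), given as the function that sends an element to the index of the
subset (the row) that contains it. -/
def Tabloid (α : ℕ →₀ ℕ) (n : ℕ) : Type :=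
  {t : Fin n → ℕ // ∀ i, (Finset.univ.filter fun x => t x = i).card = α i}

/-- The symmetric group acts on tabloids by `σ (t_1, t_2, …) = (σ(t_1), σ(t_2), …)`: the row of `x`
in `σ t` is the row of `σ⁻¹ x` in `t`. -/
instance (α : ℕ →₀ ℕ) (n : ℕ) : MulAction (Equiv.Perm (Fin n)) (Tabloid α n) where
  smul σ t := ⟨fun x => t.1 (σ⁻¹ x), fun i => by
    rw [← t.2 i]
    exact Finset.card_bij' (fun x _ => σ⁻¹ x) (fun x _ => σ x)
      (by simp) (by simp) (by simp) (by simp)⟩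
  one_smul _ := rfl
  mul_smul _ _ _ := Subtype.ext (by funext x; simp [HSMul.hSMul, mul_inv_rev])

/-- A Young tableau of shape `α` with entries `1, …, n`, each used once: a bijection from the
entries to the cells `(i, j)`, `j < α i`, of the diagram of `α` (`i` is the row, `j` the column). -/
abbrev Tableau (α : ℕ →₀ ℕ) (n : ℕ) : Type :=
  Fin n ≃ {p : ℕ × ℕ // p.2 < α p.1}

/-- The row of the entry `x`. -/
def Tableau.row {α : ℕ →₀ ℕ} {n : ℕ} (T : Tableau α n) (x : Fin n) : ℕ := (T x).1.1

/-- The column of the entry `x`. -/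
def Tableau.col {α : ℕ →₀ ℕ} {n : ℕ} (T : Tableau α n) (x : Fin n) : ℕ := (T x).1.2

/-- The tabloid of a tableau: forget the order of the entries within each row. -/
def Tableau.tabloid {α : ℕ →₀ ℕ} {n : ℕ} (T : Tableau α n) : Tabloid α n :=
  ⟨T.row, fun i => by
    rw [← Finset.card_range (α i)]
    refine Finset.card_bij' (fun x _ => T.col x)
      (fun j hj => T.symm ⟨(i, j), Finset.mem_range.mp hj⟩) ?_ ?_ ?_ ?_
    · intro x hx
      have hx' : (T x).1.1 = i := (Finset.mem_filter.mp hx).2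
      exact Finset.mem_range.mpr (hx' ▸ (T x).2)
    · intro j hj
      exact Finset.mem_filter.mpr ⟨Finset.mem_univ _, by simp [Tableau.row]⟩
    · intro x hx
      have hx' : (T x).1.1 = i := (Finset.mem_filter.mp hx).2
      rw [Equiv.symm_apply_eq]
      exact Subtype.ext (Prod.ext hx'.symm rfl)
    · intro j hj
      simp [Tableau.col]⟩

/-- The tableau with the entry `x` replaced by `σ x`, for every `x`. -/
def Tableau.act {α : ℕ →₀ ℕ} {n : ℕ} (σ : Equiv.Perm (Fin n)) (T : Tableau α n) : Tableau α n :=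
  (σ⁻¹ : Equiv.Perm (Fin n)).trans T

/-- The permutation module `M^α`: the complex vector space with basis the `α`-tabloids. -/
noncomputable abbrev permModule (α : ℕ →₀ ℕ) (n : ℕ) :
    Representation ℂ (Equiv.Perm (Fin n)) (MonoidAlgebra ℂ (Tabloid α n)) :=
  Representation.ofMulAction ℂ (Equiv.Perm (Fin n)) (Tabloid α n)

open Classical in
/-- The column stabilizer of a tableau: the permutations that keep every entry in its column. -/
noncomputable def Tableau.colStab {α : ℕ →₀ ℕ} {n : ℕ} (T : Tableau α n) :
    Finset (Equiv.Perm (Fin n)) :=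
  Finset.univ.filter fun π => ∀ x, T.col (π x) = T.col x

/-- The polytabloid of a tableau: the sum of `sgn(π) π{T}` over the column stabilizer. -/
noncomputable def Tableau.polytabloid {α : ℕ →₀ ℕ} {n : ℕ} (T : Tableau α n) :
    MonoidAlgebra ℂ (Tabloid α n) :=
  ∑ π ∈ T.colStab, MonoidAlgebra.single (π • T.tabloid) ((Equiv.Perm.sign π : ℤ) : ℂ)

theorem permModule_polytabloid {α : ℕ →₀ ℕ} {n : ℕ} (σ : Equiv.Perm (Fin n)) (T : Tableau α n) :
    permModule α n σ T.polytabloid = (T.act σ).polytabloid := by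
  rw [Tableau.polytabloid, map_sum, Tableau.polytabloid]
  refine Finset.sum_bij' (fun π _ => σ * π * σ⁻¹) (fun π _ => σ⁻¹ * π * σ) ?_ ?_ ?_ ?_ ?_
  · intro π hπ
    have h := (Finset.mem_filter.mp hπ).2
    refine Finset.mem_filter.mpr ⟨Finset.mem_univ _, fun x => ?_⟩
    simpa [Tableau.col, Tableau.act] using h (σ⁻¹ x)
  · intro π hπ
    have h := (Finset.mem_filter.mp hπ).2
    refine Finset.mem_filter.mpr ⟨Finset.mem_univ _, fun x => ?_⟩
    simpa [Tableau.col, Tableau.act] using h (σ x)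
  · intro π _; group
  · intro π _; group
  · intro π _
    have h : (T.act σ).tabloid = σ • T.tabloid := rfl
    have hs : Equiv.Perm.sign (σ * π * σ⁻¹) = Equiv.Perm.sign π := by
      rw [map_mul, map_mul, map_inv, mul_right_comm, mul_inv_cancel, one_mul]
    rw [Representation.ofMulAction_single, h, smul_smul, smul_smul, hs, inv_mul_cancel_right]

/-- The Specht module `S^α`, as a subrepresentation of `M^α`: the span of the polytabloids. -/
noncomputable def specht (α : ℕ →₀ ℕ) (n : ℕ) : Subrepresentation (permModule α n) where
  toSubmodule := Submodule.span ℂ (Set.range fun T : Tableau α n => T.polytabloid)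
  apply_mem_toSubmodule σ v hv := by
    induction hv using Submodule.span_induction with
    | mem x h =>
      obtain ⟨T, rfl⟩ := h
      exact Submodule.subset_span ⟨T.act σ, (permModule_polytabloid σ T).symm⟩
    | zero => simp
    | add x y _ _ hx hy => rw [map_add]; exact Submodule.add_mem _ hx hy
    | smul a x _ hx => rw [map_smul]; exact Submodule.smul_mem _ a hx

/-- The irreducible character `ζ^α` of the symmetric group of degree `n` that corresponds to the
partition `α` of `n`: the character of the Specht module `S^α` over `ℂ`. -/
noncomputable def zeta (α : ℕ →₀ ℕ) (n : ℕ) : Equiv.Perm (Fin n) → ℂ :=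
  (specht α n).toRepresentation.character

/-- The value `ζ^α_β = ζ^α(σ_β)`, where `α` is a partition of `|β|`. -/
noncomputable def zetaVal (α β : ℕ →₀ ℕ) : ℂ :=
  zeta α β.degree (stdPerm β)

end SymChar

universe u

namespace SymChar

open Equiv

/-! Let `m = |β|` and `n = m + 1`, and let `σ_β` also act on `n` points, fixing the last. Both sides
equal the sum over `k ≤ m` of `ζ^α((n k) σ_β)`.

Right side: `(n k) σ_β` is `σ_β` with `n` inserted into the cycle through `k`. Each of the `β_j`
elements `k` of block `j` thus gives the cycle type of `β + ε_j` (`sum_zeta_swap_eq`).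

Left side: the sum of all transpositions acts on `S^α` by a scalar. A transposition moved to the
right of the column antisymmetrizer acts by `1` on entries of one row, `-1` on entries of one column
and `0` otherwise (`antisum_swap`). The sum of the `(n k)` is the difference of these central
elements for `S_n` and `S_m`. So on the constituent `S^{α-ε_i}` of the restriction it acts by the
content `α_i - i` of the removed box (`sum_zeta_swap_last`).

This needs the branching rule `zeta_succPerm`. Filter `S^α` by the spans of polytabloids whose last
entry lies in a column not meeting row `r`. Deleting the last entry from row `r` maps step `r + 1`
onto `S^{α-ε_r}` when row `r` ends in a corner; otherwise the two steps coincide. The kernel is only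
step `r`, because an inverse modulo step `r` exists: extending a tableau by the last entry respects
the Garnir relations modulo step `r`, and these relations present the Specht module
(`IsGarnir.exists_linearMap`). The presentation follows by induction on `n` from the same
filtration, applied to pairs of a polytabloid and a prescribed value. No basis of standard
polytabloids is used. -/

theorem apply_inv_self {ι : Type*} (π : Perm ι) (x : ι) : π (π⁻¹ x) = x := π.apply_symm_apply x

theorem inv_apply_self {ι : Type*} (π : Perm ι) (x : ι) : π⁻¹ (π x) = x := π.symm_apply_apply x

/-- The sign of a permutation as a complex number. -/
noncomputable def sgn {n : ℕ} (π : Perm (Fin n)) : ℂ := ((Perm.sign π : ℤ) : ℂ)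

@[simp] theorem sgn_one {n : ℕ} : sgn (1 : Perm (Fin n)) = 1 := by simp [sgn]

theorem sgn_mul {n : ℕ} (π τ : Perm (Fin n)) : sgn (π * τ) = sgn π * sgn τ := by simp [sgn]

theorem sgn_mul_self {n : ℕ} (π : Perm (Fin n)) : sgn π * sgn π = 1 := by
  rw [← sgn_mul, sgn, map_mul, Int.units_mul_self]; simp

@[simp] theorem sgn_inv {n : ℕ} (π : Perm (Fin n)) : sgn π⁻¹ = sgn π := by simp [sgn]

theorem sgn_swap {n : ℕ} {x y : Fin n} (h : x ≠ y) : sgn (swap x y) = -1 := by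
  simp [sgn, Perm.sign_swap h]

/-! ### Actions on tabloids and tableaux -/

theorem Tabloid.smul_val {α : ℕ →₀ ℕ} {n : ℕ} (σ : Perm (Fin n)) (t : Tabloid α n) (x : Fin n) :
    (σ • t).1 x = t.1 (σ⁻¹ x) := rfl

theorem Tabloid.swap_smul {α : ℕ →₀ ℕ} {n : ℕ} {t : Tabloid α n} {x y : Fin n}
    (h : t.1 x = t.1 y) : swap x y • t = t := by
  refine Subtype.ext (funext fun z => ?_)
  rw [Tabloid.smul_val, swap_inv]
  rcases eq_or_ne z x with rfl | hx
  · rw [swap_apply_left, h]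
  rcases eq_or_ne z y with rfl | hy
  · rw [swap_apply_right, h]
  rw [swap_apply_of_ne_of_ne hx hy]

namespace Tableau

variable {α : ℕ →₀ ℕ} {n : ℕ}

theorem act_mul (σ τ : Perm (Fin n)) (T : Tableau α n) : T.act (σ * τ) = (T.act τ).act σ := rfl

theorem col_act (σ : Perm (Fin n)) (T : Tableau α n) (x : Fin n) :
    (T.act σ).col x = T.col (σ⁻¹ x) := rfl

theorem row_act (σ : Perm (Fin n)) (T : Tableau α n) (x : Fin n) :
    (T.act σ).row x = T.row (σ⁻¹ x) := rfl

theorem tabloid_val (T : Tableau α n) (x : Fin n) : T.tabloid.1 x = T.row x := rfl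

theorem tabloid_act (σ : Perm (Fin n)) (T : Tableau α n) :
    (T.act σ).tabloid = σ • T.tabloid := rfl

theorem col_lt (T : Tableau α n) (x : Fin n) : T.col x < α (T.row x) := (T x).2

theorem ext_row_col (T : Tableau α n) {x y : Fin n} (hr : T.row x = T.row y)
    (hc : T.col x = T.col y) : x = y :=
  T.injective (Subtype.ext (Prod.ext hr hc))

theorem exists_row_col (T : Tableau α n) {i j : ℕ} (h : j < α i) :
    ∃ x, T.row x = i ∧ T.col x = j :=
  ⟨T.symm ⟨(i, j), h⟩, by simp [row], by simp [col]⟩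

theorem mem_colStab {T : Tableau α n} {π : Perm (Fin n)} :
    π ∈ T.colStab ↔ ∀ x, T.col (π x) = T.col x := by
  simp [colStab]

theorem mul_mem_colStab {T : Tableau α n} {π τ : Perm (Fin n)} (hτ : τ ∈ T.colStab) :
    π * τ ∈ T.colStab ↔ π ∈ T.colStab := by
  rw [mem_colStab] at hτ
  simp only [mem_colStab, Perm.mul_apply]
  refine ⟨fun h x => ?_, fun h x => by rw [h, hτ]⟩
  have h1 := h (τ⁻¹ x)
  have h2 := hτ (τ⁻¹ x)
  rw [apply_inv_self] at h1 h2
  rw [h1, h2]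

theorem inv_mem_colStab {T : Tableau α n} {π : Perm (Fin n)} (h : π ∈ T.colStab) :
    π⁻¹ ∈ T.colStab := by
  rw [mem_colStab] at *
  intro x
  rw [← h (π⁻¹ x), apply_inv_self]

theorem swap_mem_colStab {T : Tableau α n} {x y : Fin n} (h : T.col x = T.col y) :
    swap x y ∈ T.colStab := by
  rw [mem_colStab]
  intro z
  rcases eq_or_ne z x with rfl | hx
  · rw [swap_apply_left, h]
  rcases eq_or_ne z y with rfl | hy
  · rw [swap_apply_right, h]
  rw [swap_apply_of_ne_of_ne hx hy]

end Tableau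

/-! ### Antisymmetrization and Garnir relations -/

/-- The signed sum of the translates of a tabloid by a finite set of permutations. -/
noncomputable def antisum {α : ℕ →₀ ℕ} {n : ℕ} (H : Finset (Perm (Fin n))) (t : Tabloid α n) :
    MonoidAlgebra ℂ (Tabloid α n) :=
  ∑ π ∈ H, MonoidAlgebra.single (π • t) (sgn π)

theorem polytabloid_eq_antisum {α : ℕ →₀ ℕ} {n : ℕ} (T : Tableau α n) :
    T.polytabloid = antisum T.colStab T.tabloid := rfl

theorem antisum_smul {α : ℕ →₀ ℕ} {n : ℕ} {H : Finset (Perm (Fin n))} {τ : Perm (Fin n)}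
    (h : ∀ π, π * τ ∈ H ↔ π ∈ H) (t : Tabloid α n) :
    antisum H (τ • t) = sgn τ • antisum H t := by
  rw [antisum, antisum, Finset.smul_sum]
  refine Finset.sum_bij' (fun π _ => π * τ) (fun π _ => π * τ⁻¹) (fun π hπ => (h π).2 hπ)
    (fun π hπ => (h _).1 (by simpa using hπ)) (by simp) (by simp) ?_
  intro π _
  rw [MonoidAlgebra.smul_single, smul_smul, sgn_mul, smul_eq_mul, mul_comm (sgn π), ← mul_assoc,
    sgn_mul_self, one_mul]

/-- The swap fixes `t` and is absorbed by `H` at the cost of a sign, so the sum equals its own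
negative. -/
theorem antisum_eq_zero {α : ℕ →₀ ℕ} {n : ℕ} {H : Finset (Perm (Fin n))} {t : Tabloid α n}
    {x y : Fin n} (hxy : x ≠ y) (h : ∀ π, π * swap x y ∈ H ↔ π ∈ H) (ht : t.1 x = t.1 y) :
    antisum H t = 0 := by
  have := antisum_smul h t
  rw [Tabloid.swap_smul ht, sgn_swap hxy, neg_one_smul, eq_neg_iff_add_eq_zero,
    ← two_smul ℂ] at this
  exact (smul_eq_zero.1 this).resolve_left two_ne_zero

theorem polytabloid_act {α : ℕ →₀ ℕ} {n : ℕ} {T : Tableau α n} {π : Perm (Fin n)}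
    (h : π ∈ T.colStab) : (T.act π).polytabloid = sgn π • T.polytabloid := by
  have hs : (T.act π).colStab = T.colStab := by
    ext τ
    have h' := Tableau.mem_colStab.1 (Tableau.inv_mem_colStab h)
    simp only [Tableau.mem_colStab, Tableau.col_act, h']
  rw [polytabloid_eq_antisum, polytabloid_eq_antisum, hs, Tableau.tabloid_act]
  exact antisum_smul (fun τ => Tableau.mul_mem_colStab h) _

open Classical in
/-- The permutations that fix all elements outside `X`. -/
noncomputable def permsOn {n : ℕ} (X : Finset (Fin n)) : Finset (Perm (Fin n)) :=
  Finset.univ.filter fun π => ∀ x, x ∉ X → π x = x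

theorem mem_permsOn {n : ℕ} {X : Finset (Fin n)} {π : Perm (Fin n)} :
    π ∈ permsOn X ↔ ∀ x, x ∉ X → π x = x := by
  simp [permsOn]

theorem mul_mem_permsOn {n : ℕ} {X : Finset (Fin n)} {π τ : Perm (Fin n)} (hτ : τ ∈ permsOn X) :
    π * τ ∈ permsOn X ↔ π ∈ permsOn X := by
  rw [mem_permsOn] at hτ
  simp only [mem_permsOn, Perm.mul_apply]
  exact forall₂_congr fun x hx => by rw [hτ x hx]

theorem swap_mem_permsOn {n : ℕ} {X : Finset (Fin n)} {x y : Fin n} (hx : x ∈ X) (hy : y ∈ X) :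
    swap x y ∈ permsOn X :=
  mem_permsOn.2 fun z hz => swap_apply_of_ne_of_ne (by rintro rfl; exact hz hx)
    (by rintro rfl; exact hz hy)

theorem mem_of_mem_permsOn {n : ℕ} {X : Finset (Fin n)} {π : Perm (Fin n)} (hπ : π ∈ permsOn X)
    {x : Fin n} (hx : x ∈ X) : π⁻¹ x ∈ X := by
  by_contra h
  have := mem_permsOn.1 hπ _ h
  rw [apply_inv_self] at this
  exact h (this ▸ hx)

/-- A function on tableaux that satisfies the column antisymmetry and the Garnir relations. -/
structure IsGarnir {α : ℕ →₀ ℕ} {n : ℕ} {W : Type*} [AddCommGroup W] [Module ℂ W]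
    (φ : Tableau α n → W) : Prop where
  anti : ∀ (T : Tableau α n) (π : Perm (Fin n)), π ∈ T.colStab → φ (T.act π) = sgn π • φ T
  garnir : ∀ (T : Tableau α n) (c c' : ℕ) (X : Finset (Fin n)), c < c' →
    (∀ x ∈ X, T.col x = c ∨ T.col x = c') → (Finset.univ.filter (T.col · = c)).card < X.card →
    ∑ π ∈ permsOn X, sgn π • φ (T.act π) = 0

theorem IsGarnir.prod {α : ℕ →₀ ℕ} {n : ℕ} {W W' : Type*} [AddCommGroup W] [Module ℂ W]
    [AddCommGroup W'] [Module ℂ W'] {φ : Tableau α n → W} {φ' : Tableau α n → W'}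
    (h : IsGarnir φ) (h' : IsGarnir φ') : IsGarnir fun T => (φ T, φ' T) where
  anti T π hπ := by rw [h.anti T π hπ, h'.anti T π hπ, Prod.smul_mk]
  garnir T c c' X hc hX hl := by
    refine Prod.ext ?_ ?_
    · simpa [Prod.fst_sum] using h.garnir T c c' X hc hX hl
    · simpa [Prod.snd_sum] using h'.garnir T c c' X hc hX hl

theorem isGarnir_polytabloid {α : ℕ →₀ ℕ} {n : ℕ} :
    IsGarnir (Tableau.polytabloid : Tableau α n → MonoidAlgebra ℂ (Tabloid α n)) where
  anti T π hπ := polytabloid_act hπ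
  garnir T c c' X hc hX hl := by
    have h1 : ∀ π ∈ permsOn X, sgn π • (T.act π).polytabloid =
        ∑ τ ∈ T.colStab, sgn τ • MonoidAlgebra.single (π • τ • T.tabloid) (sgn π) := by
      intro π _
      rw [← permModule_polytabloid, Tableau.polytabloid, map_sum, Finset.smul_sum]
      refine Finset.sum_congr rfl fun τ _ => ?_
      rw [Representation.ofMulAction_single, MonoidAlgebra.smul_single, MonoidAlgebra.smul_single,
        smul_eq_mul, smul_eq_mul, mul_comm]
      rfl
    rw [Finset.sum_congr rfl h1, Finset.sum_comm]
    refine Finset.sum_eq_zero fun τ hτ => ?_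
    rw [← Finset.smul_sum]
    change sgn τ • antisum (permsOn X) (τ • T.tabloid) = 0
    have hτ' := Tableau.mem_colStab.1 (Tableau.inv_mem_colStab hτ)
    -- Since `c < c'`, every row of `τ{T}` containing an element of `X` meets column `c`. There are
    -- fewer such rows than elements of `X`, so two elements share a row and the antisymmetrization
    -- over `X` kills the tabloid.
    have hlt : ((Finset.univ.filter (T.col · = c)).image T.row).card < X.card :=
      Finset.card_image_le.trans_lt hl
    obtain ⟨x, hx, y, hy, hxy, he⟩ := Finset.exists_ne_map_eq_of_card_lt_of_maps_to hlt
      (f := fun x => T.row (τ⁻¹ x)) (by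
        intro x hx
        have h2 : c < α (T.row (τ⁻¹ x)) := by
          have h3 := T.col_lt (τ⁻¹ x)
          rw [hτ' x] at h3
          have := hX x hx
          omega
        obtain ⟨y, hy1, hy2⟩ := T.exists_row_col h2
        exact Finset.mem_image.2 ⟨y, by simp [hy2], hy1⟩)
    rw [antisum_eq_zero hxy (fun π => mul_mem_permsOn (swap_mem_permsOn hx hy)) he, smul_zero]

/-! ### Permutations fixing the last element -/

/-- The permutation of `m + 1` elements that acts as `σ` on the first `m` and fixes the last. -/
noncomputable def succPerm {m : ℕ} (σ : Perm (Fin m)) : Perm (Fin (m + 1)) :=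
  finSuccEquivLast.symm.permCongr (optionCongr σ)

@[simp] theorem succPerm_castSucc {m : ℕ} (σ : Perm (Fin m)) (x : Fin m) :
    succPerm σ x.castSucc = (σ x).castSucc := by
  simp [succPerm, Equiv.permCongr_apply]

@[simp] theorem succPerm_last {m : ℕ} (σ : Perm (Fin m)) :
    succPerm σ (Fin.last m) = Fin.last m := by
  simp [succPerm, Equiv.permCongr_apply]

@[simp] theorem succPerm_inv {m : ℕ} (σ : Perm (Fin m)) : (succPerm σ)⁻¹ = succPerm σ⁻¹ := by
  rw [inv_eq_iff_mul_eq_one]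
  ext x
  induction x using Fin.lastCases <;> simp

theorem succPerm_mul {m : ℕ} (σ τ : Perm (Fin m)) :
    succPerm (σ * τ) = succPerm σ * succPerm τ := by
  ext x
  induction x using Fin.lastCases <;> simp

theorem succPerm_injective {m : ℕ} : Function.Injective (succPerm (m := m)) := by
  intro σ τ h
  ext x
  simpa using congrArg (fun π => (π x.castSucc).1) h

@[simp] theorem sgn_succPerm {m : ℕ} (σ : Perm (Fin m)) : sgn (succPerm σ) = sgn σ := by
  simp [sgn, succPerm]

theorem exists_succPerm {m : ℕ} {π : Perm (Fin (m + 1))} (h : π (Fin.last m) = Fin.last m) :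
    ∃ σ, succPerm σ = π := by
  have hne : ∀ x : Fin m, π x.castSucc ≠ Fin.last m := fun x hx =>
    (Fin.castSucc_lt_last x).ne (π.injective (hx.trans h.symm))
  have hinj : Function.Injective fun x => (π x.castSucc).castPred (hne x) := by
    intro x y hxy
    simpa [Fin.castPred_inj] using hxy
  refine ⟨Equiv.ofBijective _ (Finite.injective_iff_bijective.1 hinj), ?_⟩
  ext x
  induction x using Fin.lastCases <;> simp [h]

/-- Sums over permutations that fix the last element. -/
theorem sum_succPerm {m : ℕ} {W : Type*} [AddCommMonoid W] {H : Finset (Perm (Fin m))}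
    {H' : Finset (Perm (Fin (m + 1)))} (hH : ∀ σ, succPerm σ ∈ H' ↔ σ ∈ H)
    {f : Perm (Fin (m + 1)) → W} (hf : ∀ π ∈ H', π (Fin.last m) ≠ Fin.last m → f π = 0) :
    ∑ σ ∈ H, f (succPerm σ) = ∑ π ∈ H', f π := by
  refine Finset.sum_of_injOn succPerm succPerm_injective.injOn (fun σ hσ => (hH σ).2 hσ) ?_
    (fun _ _ => rfl)
  intro π hπ hn
  refine hf π hπ fun hl => hn ?_
  obtain ⟨σ, rfl⟩ := exists_succPerm hl
  exact ⟨σ, (hH σ).1 hπ, rfl⟩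

/-! ### Adding and deleting a box at the end of a row -/

section AddBox

variable {μ α : ℕ →₀ ℕ} {r m : ℕ}

theorem addBox_apply (h : μ + Finsupp.single r 1 = α) (i : ℕ) :
    α i = μ i + if r = i then 1 else 0 := by
  rw [← h, Finsupp.add_apply, Finsupp.single_apply]

theorem addBox_self (h : μ + Finsupp.single r 1 = α) : α r = μ r + 1 := by
  simp [addBox_apply h]

theorem addBox_le (h : μ + Finsupp.single r 1 = α) (i : ℕ) : μ i ≤ α i := by
  simp [addBox_apply h]

theorem Tableau.ext' {α : ℕ →₀ ℕ} {n : ℕ} {T T' : Tableau α n} (hr : ∀ x, T.row x = T'.row x)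
    (hc : ∀ x, T.col x = T'.col x) : T = T' :=
  Equiv.ext fun x => Subtype.ext (Prod.ext (hr x) (hc x))

/-- Put a new last entry at the end of row `r` of a tableau. -/
noncomputable def Tableau.extend (h : μ + Finsupp.single r 1 = α) (T : Tableau μ m) :
    Tableau α (m + 1) :=
  Equiv.ofBijective
    (Fin.lastCases (motive := fun _ => {p : ℕ × ℕ // p.2 < α p.1})
      ⟨(r, μ r), by simp [addBox_self h]⟩
      fun x => ⟨(T x).1, (T x).2.trans_le (addBox_le h _)⟩) (by
    constructor
    · intro x y hxy
      induction x using Fin.lastCases with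
      | last =>
        induction y using Fin.lastCases with
        | last => rfl
        | cast y =>
          have h1 := (T y).2
          simp only [Fin.lastCases_last, Fin.lastCases_castSucc, Subtype.mk.injEq] at hxy
          rw [← hxy] at h1
          exact absurd h1 (lt_irrefl _)
      | cast x =>
        induction y using Fin.lastCases with
        | last =>
          have h1 := (T x).2
          simp only [Fin.lastCases_last, Fin.lastCases_castSucc, Subtype.mk.injEq] at hxy
          rw [hxy] at h1
          exact absurd h1 (lt_irrefl _)
        | cast y =>
          simp only [Fin.lastCases_castSucc, Subtype.mk.injEq] at hxy
          rw [T.injective (Subtype.ext hxy)]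
    · rintro ⟨⟨i, j⟩, hij⟩
      by_cases hm : j < μ i
      · exact ⟨(T.symm ⟨(i, j), hm⟩).castSucc, by simp⟩
      · refine ⟨Fin.last m, ?_⟩
        rw [Fin.lastCases_last]
        simp only [addBox_apply h] at hij
        split_ifs at hij with hr
        · subst hr
          exact Subtype.ext (Prod.ext rfl (by simp only; omega))
        · exact absurd hij (by simpa using hm))

variable (h : μ + Finsupp.single r 1 = α) (T : Tableau μ m)

theorem Tableau.extend_last :
    T.extend h (Fin.last m) = ⟨(r, μ r), by simp [addBox_self h]⟩ := by
  change Fin.lastCases (motive := fun _ => {p : ℕ × ℕ // p.2 < α p.1}) _ _ (Fin.last m) = _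
  rw [Fin.lastCases_last]

theorem Tableau.extend_castSucc (x : Fin m) :
    T.extend h x.castSucc = ⟨(T x).1, (T x).2.trans_le (addBox_le h _)⟩ := by
  change Fin.lastCases (motive := fun _ => {p : ℕ × ℕ // p.2 < α p.1}) _ _ x.castSucc = _
  rw [Fin.lastCases_castSucc]

@[simp] theorem Tableau.row_extend_last : (T.extend h).row (Fin.last m) = r := by
  rw [row, extend_last]

@[simp] theorem Tableau.col_extend_last : (T.extend h).col (Fin.last m) = μ r := by
  rw [col, extend_last]

@[simp] theorem Tableau.row_extend_castSucc (x : Fin m) :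
    (T.extend h).row x.castSucc = T.row x := by
  rw [row, extend_castSucc]
  rfl

@[simp] theorem Tableau.col_extend_castSucc (x : Fin m) :
    (T.extend h).col x.castSucc = T.col x := by
  rw [col, extend_castSucc]
  rfl

theorem Tableau.extend_act (σ : Perm (Fin m)) :
    (T.act σ).extend h = (T.extend h).act (succPerm σ) := by
  refine Tableau.ext' (fun x => ?_) (fun x => ?_) <;>
    induction x using Fin.lastCases <;> simp [row_act, col_act]

theorem Tableau.exists_extend {T : Tableau α (m + 1)} (hr : T.row (Fin.last m) = r)
    (hc : T.col (Fin.last m) = μ r) : ∃ T' : Tableau μ m, T'.extend h = T := by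
  have hlt : ∀ x : Fin m, (T x.castSucc).1.2 < μ (T x.castSucc).1.1 := by
    intro x
    have h1 := (T x.castSucc).2
    rw [addBox_apply h] at h1
    split_ifs at h1 with h2
    · refine lt_of_le_of_ne (Nat.lt_succ_iff.1 h1) fun h3 => ?_
      refine (Fin.castSucc_lt_last x).ne (T.ext_row_col (h2.symm.trans hr.symm) ?_)
      rw [hc, h2]
      exact h3
    · exact h1
  refine ⟨Equiv.ofBijective (fun x => ⟨(T x.castSucc).1, hlt x⟩) ⟨?_, ?_⟩, ?_⟩
  · intro x y hxy
    simp only [Subtype.mk.injEq] at hxy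
    exact Fin.castSucc_injective m (T.injective (Subtype.ext hxy))
  · rintro ⟨⟨i, j⟩, hij⟩
    obtain ⟨x, hx1, hx2⟩ := T.exists_row_col (hij.trans_le (addBox_le h i))
    induction x using Fin.lastCases with
    | last =>
      simp only at hij
      rw [← hx1, show j = μ r from hx2.symm.trans hc, hr] at hij
      exact absurd hij (lt_irrefl _)
    | cast x => exact ⟨x, Subtype.ext (Prod.ext hx1 hx2)⟩
  · refine Tableau.ext' (fun x => ?_) (fun x => ?_)
    · induction x using Fin.lastCases with
      | last => rw [row_extend_last, hr]
      | cast x => rw [row_extend_castSucc]; rfl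
    · induction x using Fin.lastCases with
      | last => rw [col_extend_last, hc]
      | cast x => rw [col_extend_castSucc]; rfl

theorem Tableau.succPerm_mem_colStab_extend {σ : Perm (Fin m)} :
    succPerm σ ∈ (T.extend h).colStab ↔ σ ∈ T.colStab := by
  simp [mem_colStab, Fin.forall_fin_succ']

/-- Remove the last element, which has to be in row `r`, from a tabloid. -/
def Tabloid.restrict (t : Tabloid α (m + 1)) (ht : t.1 (Fin.last m) = r) : Tabloid μ m :=
  ⟨fun x => t.1 x.castSucc, fun i => by
    have h1 := t.2 i
    rw [addBox_apply h, Finset.card_filter, Fin.sum_univ_castSucc, ← Finset.card_filter, ht] at h1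
    exact Nat.add_right_cancel h1⟩

/-- The linear map that keeps the tabloids with the last element in row `r`, and removes it. -/
noncomputable def restrictMap :
    MonoidAlgebra ℂ (Tabloid α (m + 1)) →ₗ[ℂ] MonoidAlgebra ℂ (Tabloid μ m) :=
  (Finsupp.linearCombination ℂ fun t : Tabloid α (m + 1) =>
    if ht : t.1 (Fin.last m) = r then MonoidAlgebra.single (t.restrict h ht) (1 : ℂ) else 0) ∘ₗ
  (MonoidAlgebra.coeffLinearEquiv ℂ).toLinearMap

theorem restrictMap_single {t : Tabloid α (m + 1)} (ht : t.1 (Fin.last m) = r) (a : ℂ) :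
    restrictMap h (MonoidAlgebra.single t a) = MonoidAlgebra.single (t.restrict h ht) a := by
  simp [restrictMap, ht]

theorem restrictMap_single_of_ne {t : Tabloid α (m + 1)} (ht : t.1 (Fin.last m) ≠ r) (a : ℂ) :
    restrictMap h (MonoidAlgebra.single t a) = 0 := by
  simp [restrictMap, ht]

theorem restrictMap_permModule (σ : Perm (Fin m)) (v : MonoidAlgebra ℂ (Tabloid α (m + 1))) :
    restrictMap h (permModule α (m + 1) (succPerm σ) v) =
      permModule μ m σ (restrictMap h v) := by
  suffices H : restrictMap h ∘ₗ permModule α (m + 1) (succPerm σ) =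
      permModule μ m σ ∘ₗ restrictMap h from LinearMap.congr_fun H v
  refine MonoidAlgebra.lhom_ext' fun t => LinearMap.ext fun a => ?_
  have hs : (succPerm σ • t).1 (Fin.last m) = t.1 (Fin.last m) := by
    simp [Tabloid.smul_val]
  simp only [LinearMap.comp_apply, MonoidAlgebra.lsingle_apply, Representation.ofMulAction_single]
  by_cases ht : t.1 (Fin.last m) = r
  · rw [restrictMap_single h (hs.trans ht), restrictMap_single h ht,
      Representation.ofMulAction_single]
    congr 1
    refine Subtype.ext (funext fun x => ?_)
    simp [Tabloid.smul_val, Tabloid.restrict]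
    rfl
  · rw [restrictMap_single_of_ne h (by rwa [hs]), restrictMap_single_of_ne h ht, map_zero]

/-- Column permutations keep the last entry in its column, which meets row `r` only in the new cell.
So the terms that survive are those of the permutations fixing the last entry. -/
theorem restrictMap_polytabloid_extend :
    restrictMap h (T.extend h).polytabloid = T.polytabloid := by
  rw [Tableau.polytabloid, map_sum, Tableau.polytabloid]
  symm
  refine Eq.trans (Finset.sum_congr rfl fun σ hσ => ?_)
    (sum_succPerm (fun σ => T.succPerm_mem_colStab_extend h) ?_)
  · have ht : (succPerm σ • (T.extend h).tabloid).1 (Fin.last m) = r := by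
      simp [Tabloid.smul_val, Tableau.tabloid_val]
    refine Eq.trans ?_ (restrictMap_single h ht _).symm
    change MonoidAlgebra.single _ (sgn σ) = MonoidAlgebra.single _ (sgn (succPerm σ))
    rw [sgn_succPerm]
    congr 1
    refine Subtype.ext (funext fun x => ?_)
    simp [Tabloid.smul_val, Tabloid.restrict, Tableau.tabloid_val]
  · intro π hπ hl
    refine restrictMap_single_of_ne h (fun hr => hl ?_) _
    rw [Tabloid.smul_val, Tableau.tabloid_val] at hr
    have hc := Tableau.mem_colStab.1 (Tableau.inv_mem_colStab hπ) (Fin.last m)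
    have := (T.extend h).ext_row_col (hr.trans (T.row_extend_last h).symm) hc
    nth_rw 1 [← this]
    exact apply_inv_self π _

/-- The last entry never leaves its column, and that column does not meet row `r`. -/
theorem restrictMap_polytabloid_eq_zero {T : Tableau α (m + 1)}
    (hT : α r ≤ T.col (Fin.last m)) : restrictMap h T.polytabloid = 0 := by
  rw [Tableau.polytabloid, map_sum]
  refine Finset.sum_eq_zero fun π hπ => restrictMap_single_of_ne h (fun hr => ?_) _
  rw [Tabloid.smul_val, Tableau.tabloid_val] at hr
  have hc := Tableau.mem_colStab.1 (Tableau.inv_mem_colStab hπ) (Fin.last m)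
  have := T.col_lt (π⁻¹ (Fin.last m))
  rw [hc, hr] at this
  omega

end AddBox

/-! ### Filtration by the column of the last entry -/

theorem apply_mem_of_mem_permsOn {n : ℕ} {X : Finset (Fin n)} {π : Perm (Fin n)}
    (hπ : π ∈ permsOn X) {x : Fin n} (hx : x ∈ X) : π x ∈ X := by
  by_contra h
  exact h ((π.injective (mem_permsOn.1 hπ _ h)).symm ▸ hx)

theorem one_mem_permsOn {n : ℕ} (X : Finset (Fin n)) : 1 ∈ permsOn X :=
  mem_permsOn.2 fun _ _ => rfl

theorem IsGarnir.eq_smul {α : ℕ →₀ ℕ} {n : ℕ} {W : Type*} [AddCommGroup W] [Module ℂ W]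
    {φ : Tableau α n → W} (hφ : IsGarnir φ) {T : Tableau α n} {π : Perm (Fin n)}
    (hπ : π ∈ T.colStab) : φ T = sgn π • φ (T.act π) := by
  rw [hφ.anti T π hπ, smul_smul, sgn_mul_self, one_smul]

/-- Signed values depend only on the coset of `π` modulo the column stabilizer of `T`, since `π τ
π⁻¹` stabilizes the columns of `T.act π`. -/
theorem IsGarnir.smul_act_mul {α : ℕ →₀ ℕ} {n : ℕ} {W : Type*} [AddCommGroup W] [Module ℂ W]
    {φ : Tableau α n → W} (hφ : IsGarnir φ) {T : Tableau α n} (π : Perm (Fin n))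
    {τ : Perm (Fin n)} (hτ : τ ∈ T.colStab) :
    sgn (π * τ) • φ (T.act (π * τ)) = sgn π • φ (T.act π) := by
  have h1 : π * τ = π * τ * π⁻¹ * π := by group
  have h2 : π * τ * π⁻¹ ∈ (T.act π).colStab := by
    rw [Tableau.mem_colStab] at hτ ⊢
    intro x
    simp only [Tableau.col_act, Perm.mul_apply, inv_apply_self]
    exact hτ _
  rw [h1, Tableau.act_mul, hφ.anti _ _ h2, smul_smul, ← sgn_mul, mul_assoc, mul_assoc, sgn_mul,
    sgn_mul, sgn_mul, sgn_inv]
  congr 1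
  calc _ = sgn π * (sgn π * sgn π) * (sgn π * sgn π) * (sgn τ * sgn τ) := by
        simp only [sgn_mul, sgn_inv]; ring
    _ = sgn π := by simp only [sgn_mul_self, mul_one]

theorem Tableau.card_col {α : ℕ →₀ ℕ} {n r c : ℕ} (hα : Antitone α) (T : Tableau α n)
    (h1 : α (r + 1) ≤ c) (h2 : c < α r) :
    (Finset.univ.filter (T.col · = c)).card = r + 1 := by
  rw [← Finset.card_range (r + 1)]
  refine Finset.card_nbij T.row ?_ ?_ ?_
  · intro x hx
    have hx' : T.col x = c := by simpa using hx
    have h3 := T.col_lt x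
    rw [hx'] at h3
    simp only [Finset.coe_range, Set.mem_Iio]
    by_contra h4
    have := hα (not_lt.1 h4)
    omega
  · intro x hx y hy hxy
    have hx' : T.col x = c := by simpa using hx
    have hy' : T.col y = c := by simpa using hy
    exact T.ext_row_col hxy (hx'.trans hy'.symm)
  · intro i hi
    have hi' : i ≤ r := by simpa [Nat.lt_succ_iff] using hi
    obtain ⟨x, hx1, hx2⟩ := T.exists_row_col (h2.trans_le (hα hi'))
    exact ⟨x, by simpa using hx2, hx1⟩

section TailSpan

variable {α : ℕ →₀ ℕ} {m : ℕ} {W : Type*} [AddCommGroup W] [Module ℂ W]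

/-- The span of the values on the tableaux with the last entry in a column that does not meet
row `r`. -/
def tailSpan (φ : Tableau α (m + 1) → W) (r : ℕ) : Submodule ℂ W :=
  Submodule.span ℂ (φ '' {T | α r ≤ T.col (Fin.last m)})

theorem mem_tailSpan (φ : Tableau α (m + 1) → W) {r : ℕ} {T : Tableau α (m + 1)}
    (h : α r ≤ T.col (Fin.last m)) : φ T ∈ tailSpan φ r :=
  Submodule.subset_span ⟨T, h, rfl⟩

theorem tailSpan_zero (hα : Antitone α) (φ : Tableau α (m + 1) → W) : tailSpan φ 0 = ⊥ := by
  rw [tailSpan, Submodule.span_eq_bot]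
  rintro _ ⟨T, hT, rfl⟩
  have h1 := T.col_lt (Fin.last m)
  have h2 := hα (Nat.zero_le (T.row (Fin.last m)))
  have h3 : α 0 ≤ T.col (Fin.last m) := hT
  omega

theorem tailSpan_of_eq_zero {r : ℕ} (hr : α r = 0) (φ : Tableau α (m + 1) → W) :
    tailSpan φ r = Submodule.span ℂ (Set.range φ) := by
  rw [tailSpan, ← Set.image_univ]
  congr 2
  simp [hr]

theorem tailSpan_mono (hα : Antitone α) (φ : Tableau α (m + 1) → W) : Monotone (tailSpan φ) :=
  fun _ _ hrs => Submodule.span_mono (Set.image_mono fun _ hT => (hα hrs).trans hT)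

/-- Columns `α (r + 1), …, α r - 1` all have height `r + 1`. Garnir relations push the last entry
rightwards through them to the last one, where column antisymmetry moves it down to row `r`. -/
theorem IsGarnir.mem_span_corner {φ : Tableau α (m + 1) → W} (hφ : IsGarnir φ) (hα : Antitone α)
    {r : ℕ} {T : Tableau α (m + 1)} (h1 : α (r + 1) ≤ T.col (Fin.last m))
    (h2 : T.col (Fin.last m) < α r) :
    φ T ∈ Submodule.span ℂ
      (φ '' {T | T.row (Fin.last m) = r ∧ T.col (Fin.last m) + 1 = α r}) := by
  obtain ⟨d, hd⟩ : ∃ d, T.col (Fin.last m) + d + 1 = α r :=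
    -- `d` is the number of columns still to be crossed.
    ⟨α r - T.col (Fin.last m) - 1, by omega⟩
  induction d generalizing T with
  | zero =>
    obtain ⟨y, hy1, hy2⟩ := T.exists_row_col h2
    have hs : swap (Fin.last m) y ∈ T.colStab := Tableau.swap_mem_colStab hy2.symm
    rw [hφ.eq_smul hs]
    refine Submodule.smul_mem _ _ (Submodule.subset_span ⟨_, ⟨?_, ?_⟩, rfl⟩)
    · simpa [Tableau.row_act] using hy1
    · simpa [Tableau.col_act, hy2] using hd
  | succ d ih =>
    set c := T.col (Fin.last m) with hc
    set B := Finset.univ.filter (T.col · = c + 1) with hB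
    have hlB : Fin.last m ∉ B := by simp [hB, ← hc]
    have hg := hφ.garnir T c (c + 1) (insert (Fin.last m) B) (Nat.lt_succ_self c)
      (fun x hx => by
        rcases Finset.mem_insert.1 hx with rfl | hx
        · exact Or.inl rfl
        · exact Or.inr (Finset.mem_filter.1 hx).2)
      (by
        rw [Finset.card_insert_of_notMem hlB, T.card_col hα h1 h2,
          T.card_col (r := r) hα (by omega) (by omega)]
        exact Nat.lt_succ_self _)
    -- Permutations fixing the last entry preserve columns, so each contributes `φ T`. All others
    -- put the last entry in column `c + 1`, where induction applies. The number of the former is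
    -- invertible in `ℂ`.
    rw [← Finset.sum_filter_add_sum_filter_not _ (fun π => π (Fin.last m) = Fin.last m),
      add_eq_zero_iff_eq_neg] at hg
    have hfix : ∀ π ∈ (permsOn (insert (Fin.last m) B)).filter
        (fun π => π (Fin.last m) = Fin.last m), sgn π • φ (T.act π) = φ T := by
      intro π hπ
      obtain ⟨hπ, hl⟩ := Finset.mem_filter.1 hπ
      refine (hφ.eq_smul (Tableau.mem_colStab.2 fun x => ?_)).symm
      by_cases hx : x ∈ B
      · have h3 := apply_mem_of_mem_permsOn hπ (Finset.mem_insert_of_mem hx)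
        rcases Finset.mem_insert.1 h3 with h3 | h3
        · rw [π.injective (h3.trans hl.symm)] at hx
          exact absurd hx hlB
        · rw [(Finset.mem_filter.1 h3).2, (Finset.mem_filter.1 hx).2]
      · rcases eq_or_ne x (Fin.last m) with rfl | hxl
        · rw [hl]
        · rw [mem_permsOn.1 hπ x (by simp [hx, hxl])]
    rw [Finset.sum_congr rfl hfix, Finset.sum_const, ← Nat.cast_smul_eq_nsmul ℂ] at hg
    have hpos : ((((permsOn (insert (Fin.last m) B)).filter
        (fun π => π (Fin.last m) = Fin.last m)).card : ℕ) : ℂ) ≠ 0 := by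
      rw [Nat.cast_ne_zero, Finset.card_ne_zero]
      exact ⟨1, Finset.mem_filter.2 ⟨one_mem_permsOn _, rfl⟩⟩
    rw [← Submodule.smul_mem_iff _ hpos, hg]
    refine Submodule.neg_mem _ (Submodule.sum_mem _ fun π hπ => Submodule.smul_mem _ _ ?_)
    obtain ⟨hπ, hl⟩ := Finset.mem_filter.1 hπ
    have h3 : T.col (π⁻¹ (Fin.last m)) = c + 1 := by
      rcases Finset.mem_insert.1 (mem_of_mem_permsOn hπ (Finset.mem_insert_self _ B)) with h4 | h4
      · exact absurd (by rw [← h4, apply_inv_self, h4]) hl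
      · exact (Finset.mem_filter.1 h4).2
    have h4 : (T.act π).col (Fin.last m) = c + 1 := h3
    exact ih (by omega) (by omega) (by omega)

variable {μ : ℕ →₀ ℕ} {r : ℕ}

theorem IsGarnir.tailSpan_succ_le {φ : Tableau α (m + 1) → W} (hφ : IsGarnir φ)
    (hα : Antitone α) (h : μ + Finsupp.single r 1 = α) :
    tailSpan φ (r + 1) ≤
      tailSpan φ r ⊔ Submodule.span ℂ (Set.range fun T : Tableau μ m => φ (T.extend h)) := by
  refine Submodule.span_le.2 ?_
  rintro _ ⟨T, hT, rfl⟩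
  rcases le_or_gt (α r) (T.col (Fin.last m)) with h1 | h1
  · exact Submodule.mem_sup_left (mem_tailSpan φ h1)
  · refine Submodule.mem_sup_right (Submodule.span_mono ?_ (hφ.mem_span_corner hα hT h1))
    rintro _ ⟨T, ⟨hr, hc⟩, rfl⟩
    obtain ⟨T', rfl⟩ := Tableau.exists_extend h hr (by rw [addBox_self h] at hc; omega)
    exact ⟨T', rfl⟩

/-- Modulo the values with the last entry further to the right, the Garnir relations restrict. -/
theorem IsGarnir.extend {φ : Tableau α (m + 1) → W} (hφ : IsGarnir φ)
    (h : μ + Finsupp.single r 1 = α) :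
    IsGarnir fun T : Tableau μ m => (tailSpan φ r).mkQ (φ (T.extend h)) where
  anti T π hπ := by
    rw [T.extend_act h, hφ.anti _ _ ((T.succPerm_mem_colStab_extend h).2 hπ), sgn_succPerm,
      map_smul]
  garnir T c c' X hc hX hl := by
    set E := T.extend h with hE
    set Y := X.map Fin.castSuccEmb with hY
    set F : Perm (Fin (m + 1)) → W ⧸ tailSpan φ r :=
      fun π => (tailSpan φ r).mkQ (sgn π • φ (E.act π)) with hF
    have hmY : ∀ x : Fin m, x.castSucc ∈ Y ↔ x ∈ X := fun x => by simp [hY]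
    have hlY : Fin.last m ∉ Y := by
      simp [hY, Fin.castSucc_ne_last]
    have hgoal : ∑ π ∈ permsOn X, sgn π • (tailSpan φ r).mkQ (φ ((T.act π).extend h)) =
        ∑ π ∈ permsOn X, F (succPerm π) :=
      Finset.sum_congr rfl fun π _ => by
        rw [hF]
        simp only [T.extend_act h, map_smul, sgn_succPerm, hE]
    have hYcol : ∀ x ∈ Y, E.col x = c ∨ E.col x = c' := by
      intro x hx
      obtain ⟨z, hz, rfl⟩ := Finset.mem_map.1 hx
      simpa [hE] using hX z hz
    have hcard : (Finset.univ.filter (E.col · = c)).card =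
        (Finset.univ.filter (T.col · = c)).card + if μ r = c then 1 else 0 := by
      rw [Finset.card_filter, Fin.sum_univ_castSucc, Finset.card_filter]
      simp [hE]
    rw [hgoal]
    -- If the new box lies in column `c`, that column grows by one, and the new entry must join `X`
    -- to keep it large enough. Otherwise the relation for `X` carries over unchanged.
    by_cases hcr : μ r = c
    · rw [if_pos hcr] at hcard
      have hg := congrArg (tailSpan φ r).mkQ
        (hφ.garnir E c c' (insert (Fin.last m) Y) hc (fun x hx => by
          rcases Finset.mem_insert.1 hx with rfl | hx
          · left; simpa [hE] using hcr
          · exact hYcol x hx) (by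
          rw [hcard, Finset.card_insert_of_notMem hlY, hY, Finset.card_map]
          omega))
      rw [map_sum, map_zero] at hg
      change ∑ π ∈ permsOn (insert (Fin.last m) Y), F π = 0 at hg
      set Z := insert (Fin.last m) Y with hZ
      have hsum : ∑ π ∈ permsOn X, F (succPerm π) =
          ∑ π ∈ (permsOn Z).filter (fun π => π⁻¹ (Fin.last m) = Fin.last m), F π := by
        refine sum_succPerm (fun σ => ?_) fun π hπ hl => absurd ?_ hl
        · rw [Finset.mem_filter, succPerm_inv]
          simp [mem_permsOn, Fin.forall_fin_succ', hZ, hmY, Fin.castSucc_ne_last]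
        · have := (Finset.mem_filter.1 hπ).2
          nth_rw 1 [← this]
          exact apply_inv_self π _
      -- Group by the entry `y` whose cell the last entry takes. If `y` is in column `c'`, the term
      -- lies in the tail, as `c' ≥ μ r + 1 = α r`. If `y` is in column `c`, right multiplication by
      -- a column transposition identifies its fibre with that of the last entry, so the wanted sum
      -- occurs with a positive multiplicity.
      rw [← Finset.sum_fiberwise_of_maps_to (t := Z) (g := fun π => π⁻¹ (Fin.last m))
        (fun π hπ => mem_of_mem_permsOn hπ (Finset.mem_insert_self _ Y)),
        ← Finset.sum_filter_add_sum_filter_not Z (fun y => E.col y = c)] at hg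
      have h0 : ∀ y ∈ Z.filter (fun y => ¬ E.col y = c),
          ∑ π ∈ (permsOn Z).filter (fun π => π⁻¹ (Fin.last m) = y), F π = 0 := by
        intro y hy
        obtain ⟨hy, hyc⟩ := Finset.mem_filter.1 hy
        refine Finset.sum_eq_zero fun π hπ => ?_
        have hπ2 : π⁻¹ (Fin.last m) = y := (Finset.mem_filter.1 hπ).2
        simp only [hF]
        rw [Submodule.mkQ_apply, Submodule.Quotient.mk_eq_zero]
        refine Submodule.smul_mem _ _ (mem_tailSpan φ ?_)
        rw [Tableau.col_act, hπ2, addBox_self h, hcr]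
        rcases Finset.mem_insert.1 hy with rfl | hy
        · exact absurd (by simpa [hE] using hcr) hyc
        · rcases hYcol y hy with h3 | h3
          · exact absurd h3 hyc
          · omega
      have h1 : ∀ y ∈ Z.filter (fun y => E.col y = c),
          ∑ π ∈ (permsOn Z).filter (fun π => π⁻¹ (Fin.last m) = y), F π =
            ∑ π ∈ permsOn X, F (succPerm π) := by
        intro y hy
        obtain ⟨hy, hyc⟩ := Finset.mem_filter.1 hy
        have hlc : E.col (Fin.last m) = c := by simpa [hE] using hcr
        have hs : swap (Fin.last m) y ∈ E.colStab :=
          Tableau.swap_mem_colStab (hlc.trans hyc.symm)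
        have hsZ : swap (Fin.last m) y ∈ permsOn Z :=
          swap_mem_permsOn (Finset.mem_insert_self _ Y) hy
        rw [hsum]
        refine Finset.sum_bij' (fun π _ => π * swap (Fin.last m) y)
          (fun π _ => π * swap (Fin.last m) y) ?_ ?_ ?_ ?_ ?_
        · intro π hπ
          obtain ⟨hπ1, hπ2⟩ := Finset.mem_filter.1 hπ
          refine Finset.mem_filter.2 ⟨(mul_mem_permsOn hsZ).2 hπ1, ?_⟩
          rw [mul_inv_rev, Perm.mul_apply, hπ2, swap_inv, swap_apply_right]
        · intro π hπ
          obtain ⟨hπ1, hπ2⟩ := Finset.mem_filter.1 hπ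
          refine Finset.mem_filter.2 ⟨(mul_mem_permsOn hsZ).2 hπ1, ?_⟩
          rw [mul_inv_rev, Perm.mul_apply, hπ2, swap_inv, swap_apply_left]
        · intro π _; simp [mul_assoc]
        · intro π _; simp [mul_assoc]
        · intro π _
          rw [hF]
          simp only
          rw [hφ.smul_act_mul π hs]
      rw [Finset.sum_eq_zero h0, add_zero, Finset.sum_congr rfl h1, Finset.sum_const,
        ← Nat.cast_smul_eq_nsmul ℂ] at hg
      refine (smul_eq_zero.1 hg).resolve_left ?_
      rw [← ne_eq, Nat.cast_ne_zero, Finset.card_ne_zero]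
      exact ⟨Fin.last m, Finset.mem_filter.2 ⟨Finset.mem_insert_self _ Y,
        by simpa [hE] using hcr⟩⟩
    · rw [if_neg hcr, add_zero] at hcard
      have hg := congrArg (tailSpan φ r).mkQ
        (hφ.garnir E c c' Y hc hYcol (by rwa [hcard, hY, Finset.card_map]))
      rw [map_sum, map_zero] at hg
      rw [← hg]
      refine sum_succPerm (fun σ => ?_) fun π hπ hl => absurd (mem_permsOn.1 hπ _ hlY) hl
      simp [mem_permsOn, Fin.forall_fin_succ', hlY, hmY]

end TailSpan

/-! ### Presentation of the Specht module -/

theorem antitone_of_le {α : ℕ →₀ ℕ} (hα : ∀ i, α (i + 1) ≤ α i) : Antitone α :=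
  antitone_nat_of_succ_le hα

theorem len_le_iff {γ : ℕ →₀ ℕ} {l : ℕ} : len γ ≤ l ↔ ∀ k, l ≤ k → γ k = 0 := by
  refine ⟨fun h k hk => ?_, fun h => Nat.sInf_le h⟩
  have hne : {l : ℕ | ∀ k, l ≤ k → γ k = 0}.Nonempty := by
    refine ⟨γ.support.sup id + 1, fun k hk => ?_⟩
    by_contra h
    have := Finset.le_sup (f := id) (Finsupp.mem_support_iff.2 h)
    simp only [id] at this
    omega
  exact Nat.sInf_mem hne k (h.trans hk)

theorem apply_len (α : ℕ →₀ ℕ) : α (len α) = 0 :=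
  len_le_iff.1 le_rfl _ le_rfl

section Corner

variable {α : ℕ →₀ ℕ} {r : ℕ}

theorem sub_single_add (hr : α (r + 1) < α r) :
    α - Finsupp.single r 1 + Finsupp.single r 1 = α :=
  tsub_add_cancel_of_le (Finsupp.single_le_iff.2 (by omega))

theorem antitone_sub_single (hα : Antitone α) (hr : α (r + 1) < α r) :
    Antitone (α - Finsupp.single r 1 : ℕ →₀ ℕ) := by
  refine antitone_nat_of_succ_le fun i => ?_
  have h1 := hα (Nat.le_succ i)
  simp only [Finsupp.tsub_apply, Finsupp.single_apply, Nat.succ_eq_add_one] at *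
  rcases eq_or_ne r i with rfl | hi
  · simp only [if_true]
    split_ifs <;> omega
  · rw [if_neg hi]
    split_ifs <;> omega

end Corner

theorem tailSpan_succ_eq {α : ℕ →₀ ℕ} {m r : ℕ} {W : Type*} [AddCommGroup W] [Module ℂ W]
    (φ : Tableau α (m + 1) → W) (h : α (r + 1) = α r) : tailSpan φ (r + 1) = tailSpan φ r := by
  rw [tailSpan, tailSpan, h]

/-- It suffices to check generators: both sides vanish on step `r`, and `hf` gives agreement on
extended tableaux. Consequently, if `L w` restricts to zero, then `w` already lies in step `r`. -/
theorem IsGarnir.map_restrictMap {α μ : ℕ →₀ ℕ} {m r : ℕ} {W : Type*} [AddCommGroup W]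
    [Module ℂ W] {φ : Tableau α (m + 1) → W} (hφ : IsGarnir φ) (hα : Antitone α)
    (h : μ + Finsupp.single r 1 = α)
    {f : MonoidAlgebra ℂ (Tabloid μ m) →ₗ[ℂ] W ⧸ tailSpan φ r}
    (hf : ∀ T : Tableau μ m, f T.polytabloid = (tailSpan φ r).mkQ (φ (T.extend h)))
    {L : W →ₗ[ℂ] MonoidAlgebra ℂ (Tabloid α (m + 1))} (hL : ∀ T, L (φ T) = T.polytabloid)
    {w : W} (hw : w ∈ tailSpan φ (r + 1)) :
    f (restrictMap h (L w)) = (tailSpan φ r).mkQ w := by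
  suffices H : tailSpan φ (r + 1) ≤
      LinearMap.eqLocus (f ∘ₗ restrictMap h ∘ₗ L) (tailSpan φ r).mkQ from H hw
  refine (hφ.tailSpan_succ_le hα h).trans (sup_le ?_ ?_)
  · refine Submodule.span_le.2 ?_
    rintro _ ⟨T, hT, rfl⟩
    simp only [SetLike.mem_coe, LinearMap.mem_eqLocus, LinearMap.comp_apply, hL]
    rw [restrictMap_polytabloid_eq_zero h hT, map_zero, Submodule.mkQ_apply, eq_comm,
      Submodule.Quotient.mk_eq_zero]
    exact mem_tailSpan φ hT
  · refine Submodule.span_le.2 ?_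
    rintro _ ⟨T, rfl⟩
    simp only [SetLike.mem_coe, LinearMap.mem_eqLocus, LinearMap.comp_apply, hL]
    rw [restrictMap_polytabloid_extend, hf]

/-- The hypothesis says that the span of the pairs is the graph of a linear map on the span of the
`e i`. A left inverse of the first projection extends this map to all of `M`. -/
theorem exists_linearMap_of_graph {ι M W : Type*} [AddCommGroup M] [Module ℂ M] [AddCommGroup W]
    [Module ℂ W] (e : ι → M) (φ : ι → W)
    (h : ∀ w ∈ Submodule.span ℂ (Set.range fun i => (e i, φ i)), w.1 = 0 → w = 0) :
    ∃ f : M →ₗ[ℂ] W, ∀ i, f (e i) = φ i := by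
  set N := Submodule.span ℂ (Set.range fun i => (e i, φ i))
  obtain ⟨g, hg⟩ := (LinearMap.fst ℂ M W ∘ₗ N.subtype).exists_leftInverse_of_injective
    (LinearMap.ker_eq_bot'.2 fun w hw => Subtype.ext (h w w.2 hw))
  refine ⟨LinearMap.snd ℂ M W ∘ₗ N.subtype ∘ₗ g, fun i => ?_⟩
  have := LinearMap.congr_fun hg ⟨(e i, φ i), Submodule.subset_span ⟨i, rfl⟩⟩
  have h2 : g (e i) = ⟨(e i, φ i), Submodule.subset_span ⟨i, rfl⟩⟩ := this
  simp [h2]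

theorem polytabloid_ne_zero_of_fin_zero {α : ℕ →₀ ℕ} (T : Tableau α 0) : T.polytabloid ≠ 0 := by
  have : T.colStab = {1} := by
    ext π
    simp [Subsingleton.elim π 1, Tableau.mem_colStab]
  rw [polytabloid_eq_antisum, this, antisum, Finset.sum_singleton]
  simp

/-- The Garnir relations and column antisymmetry present the Specht module. -/
theorem IsGarnir.exists_linearMap {n : ℕ} : ∀ {α : ℕ →₀ ℕ}, Antitone α →
    ∀ {W : Type u} [AddCommGroup W] [Module ℂ W] {φ : Tableau α n → W}, IsGarnir φ →
    ∃ f : MonoidAlgebra ℂ (Tabloid α n) →ₗ[ℂ] W, ∀ T, f T.polytabloid = φ T := by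
  induction n with
  | zero =>
    intro α _ W _ _ φ _
    refine exists_linearMap_of_graph _ _ fun w hw hw0 => ?_
    rcases isEmpty_or_nonempty (Tableau α 0) with he | ⟨⟨T⟩⟩
    · simpa [Set.range_eq_empty] using hw
    · have hle : Submodule.span ℂ (Set.range fun T => (T.polytabloid, φ T)) ≤
          Submodule.span ℂ {(T.polytabloid, φ T)} := by
        refine Submodule.span_mono ?_
        rintro _ ⟨T', rfl⟩
        rw [Equiv.ext (fun x => x.elim0 : ∀ x, T' x = T x)]
        rfl
      obtain ⟨a, rfl⟩ := Submodule.mem_span_singleton.1 (hle hw)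
      rw [Prod.smul_fst] at hw0
      rw [(smul_eq_zero.1 hw0).resolve_right (polytabloid_ne_zero_of_fin_zero T), zero_smul]
  | succ m ih =>
    intro α hα W _ _ φ hφ
    refine exists_linearMap_of_graph _ _ ?_
    -- The filtration is applied to the graph itself: an element with first component zero descends
    -- from step `len α`, which is the whole span, to step `0`, which is zero.
    set ψ : Tableau α (m + 1) → MonoidAlgebra ℂ (Tabloid α (m + 1)) × W :=
      fun T => (T.polytabloid, φ T)
    have hψ : IsGarnir ψ := isGarnir_polytabloid.prod hφ
    rw [← tailSpan_of_eq_zero (apply_len α) ψ]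
    generalize len α = r
    induction r with
    | zero =>
      intro w hw _
      rwa [tailSpan_zero hα, Submodule.mem_bot] at hw
    | succ r hr =>
      intro w hw hw0
      refine hr w ?_ hw0
      rcases (hα (Nat.le_succ r)).lt_or_eq with hlt | heq
      · have h := sub_single_add hlt
        obtain ⟨f, hf⟩ := ih (antitone_sub_single hα hlt) (hψ.extend h)
        have := hψ.map_restrictMap hα h hf (L := LinearMap.fst ℂ _ W) (fun T => rfl) hw
        rw [LinearMap.fst_apply, hw0, map_zero, map_zero, eq_comm, Submodule.mkQ_apply,
          Submodule.Quotient.mk_eq_zero] at this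
        exact this
      · rwa [← tailSpan_succ_eq ψ heq]

/-! ### Traces and the branching rule -/

/-- Split the sequence as `i j + s g = 1` and use the cyclicity of the trace; no invariant
complement is needed. -/
theorem trace_eq_add_of_exact {P V Q : Type*} [AddCommGroup P] [Module ℂ P]
    [FiniteDimensional ℂ P] [AddCommGroup V] [Module ℂ V] [FiniteDimensional ℂ V]
    [AddCommGroup Q] [Module ℂ Q] [FiniteDimensional ℂ Q]
    {i : P →ₗ[ℂ] V} {g : V →ₗ[ℂ] Q} (hi : Function.Injective i) (hg : Function.Surjective g)
    (hig : LinearMap.range i = LinearMap.ker g) {k : P →ₗ[ℂ] P} {f : V →ₗ[ℂ] V} {h : Q →ₗ[ℂ] Q}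
    (hk : f ∘ₗ i = i ∘ₗ k) (hh : g ∘ₗ f = h ∘ₗ g) :
    LinearMap.trace ℂ V f = LinearMap.trace ℂ P k + LinearMap.trace ℂ Q h := by
  obtain ⟨s, hs⟩ := g.exists_rightInverse_of_surjective (LinearMap.range_eq_top.2 hg)
  obtain ⟨l, hl⟩ := i.exists_leftInverse_of_injective (LinearMap.ker_eq_bot.2 hi)
  have hgi : g ∘ₗ i = 0 := LinearMap.range_le_ker_iff.1 hig.le
  set j := l ∘ₗ (LinearMap.id - s ∘ₗ g) with hj
  have hij : i ∘ₗ j + s ∘ₗ g = LinearMap.id := by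
    ext v
    have hv : v - s (g v) ∈ LinearMap.range i := by
      rw [hig, LinearMap.mem_ker, map_sub, sub_eq_zero]
      exact (LinearMap.congr_fun hs (g v)).symm
    obtain ⟨p, hp⟩ := hv
    have h1 : l (i p) = p := LinearMap.congr_fun hl p
    simp [hj, ← hp, h1]
    simp [hp]
  have hji : j ∘ₗ i = LinearMap.id := by
    rw [hj, LinearMap.comp_assoc, LinearMap.sub_comp, LinearMap.comp_assoc, hgi,
      LinearMap.comp_zero, sub_zero, LinearMap.id_comp, hl]
  calc LinearMap.trace ℂ V f = LinearMap.trace ℂ V (f ∘ₗ (i ∘ₗ j + s ∘ₗ g)) := by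
        rw [hij, LinearMap.comp_id]
    _ = LinearMap.trace ℂ V ((i ∘ₗ k) ∘ₗ j) + LinearMap.trace ℂ V ((f ∘ₗ s) ∘ₗ g) := by
        rw [LinearMap.comp_add, map_add, ← LinearMap.comp_assoc, hk, ← LinearMap.comp_assoc g s f]
    _ = LinearMap.trace ℂ P (j ∘ₗ (i ∘ₗ k)) + LinearMap.trace ℂ Q (g ∘ₗ (f ∘ₗ s)) := by
        rw [LinearMap.trace_comp_comm' (i ∘ₗ k) j, LinearMap.trace_comp_comm' (f ∘ₗ s) g]
    _ = _ := by
        rw [← LinearMap.comp_assoc, hji, LinearMap.id_comp, ← LinearMap.comp_assoc, hh,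
          LinearMap.comp_assoc, hs, LinearMap.comp_id]

theorem trace_restrict_congr {E : Type*} [AddCommGroup E] [Module ℂ E] {f : E →ₗ[ℂ] E}
    {p q : Submodule ℂ E} (h : p = q) (hp : ∀ v ∈ p, f v ∈ p) (hq : ∀ v ∈ q, f v ∈ q) :
    LinearMap.trace ℂ p (f.restrict hp) = LinearMap.trace ℂ q (f.restrict hq) := by
  subst h
  rfl

theorem trace_restrict_eq_add {E F : Type*} [AddCommGroup E] [Module ℂ E] [FiniteDimensional ℂ E]
    [AddCommGroup F] [Module ℂ F] [FiniteDimensional ℂ F] {f : E →ₗ[ℂ] E} {h : F →ₗ[ℂ] F}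
    {g : E →ₗ[ℂ] F} {p q : Submodule ℂ E} {S : Submodule ℂ F} (hp : ∀ v ∈ p, f v ∈ p)
    (hq : ∀ v ∈ q, f v ∈ q) (hS : ∀ v ∈ S, h v ∈ S) (hmap : q.map g = S)
    (hpq : q ⊓ LinearMap.ker g = p) (hgf : ∀ v, g (f v) = h (g v)) :
    LinearMap.trace ℂ q (f.restrict hq) =
      LinearMap.trace ℂ p (f.restrict hp) + LinearMap.trace ℂ S (h.restrict hS) := by
  have hgq : ∀ v ∈ q, g v ∈ S := fun v hv => hmap ▸ Submodule.mem_map_of_mem hv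
  have hle : p ≤ q := hpq ▸ inf_le_left
  refine trace_eq_add_of_exact (i := Submodule.inclusion hle) (g := g.restrict hgq)
    (Submodule.inclusion_injective hle) ?_ ?_ ?_ ?_
  · rintro ⟨w, hw⟩
    obtain ⟨v, hv, rfl⟩ := Submodule.mem_map.1 (hmap ▸ hw)
    exact ⟨⟨v, hv⟩, rfl⟩
  · ext ⟨v, hv⟩
    rw [Submodule.range_inclusion, LinearMap.mem_ker, Submodule.mem_comap, ← hpq]
    simp [Subtype.ext_iff, hv]
  · rfl
  · ext ⟨v, hv⟩
    exact hgf v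

instance (α : ℕ →₀ ℕ) (n : ℕ) : Finite (Tabloid α n) := by
  have hb : ∀ (t : Tabloid α n) (x : Fin n), t.1 x ∈ α.support := fun t x => by
    rw [Finsupp.mem_support_iff, ← t.2]
    exact Finset.card_ne_zero.2 ⟨x, by simp⟩
  refine Finite.of_injective (fun (t : Tabloid α n) (x : Fin n) =>
    (⟨t.1 x, hb t x⟩ : α.support)) fun t t' h => Subtype.ext (funext fun x => ?_)
  exact congrArg Subtype.val (congrFun h x)

instance (α : ℕ →₀ ℕ) (n : ℕ) : FiniteDimensional ℂ (MonoidAlgebra ℂ (Tabloid α n)) :=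
  Module.Finite.equiv (MonoidAlgebra.coeffLinearEquiv ℂ).symm

/-- The part of the Specht module spanned by the polytabloids with the last entry in a column that
does not meet row `r`. -/
noncomputable abbrev spechtTail (α : ℕ →₀ ℕ) (m r : ℕ) :
    Submodule ℂ (MonoidAlgebra ℂ (Tabloid α (m + 1))) :=
  tailSpan (fun T : Tableau α (m + 1) => T.polytabloid) r

theorem spechtTail_invariant (α : ℕ →₀ ℕ) (r : ℕ) {m : ℕ} (σ : Perm (Fin m)) :
    ∀ v ∈ spechtTail α m r, permModule α (m + 1) (succPerm σ) v ∈ spechtTail α m r := by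
  suffices H : spechtTail α m r ≤
      (spechtTail α m r).comap (permModule α (m + 1) (succPerm σ)) from fun v hv => H hv
  refine Submodule.span_le.2 ?_
  rintro _ ⟨T, hT, rfl⟩
  simp only [SetLike.mem_coe, Submodule.mem_comap]
  rw [permModule_polytabloid]
  refine mem_tailSpan _ ?_
  rw [Tableau.col_act, succPerm_inv, succPerm_last]
  exact hT

theorem map_spechtTail_succ {α μ : ℕ →₀ ℕ} {m r : ℕ} (hα : Antitone α)
    (h : μ + Finsupp.single r 1 = α) (hμ : Antitone μ) :
    (spechtTail α m (r + 1)).map (restrictMap h) = (specht μ m).toSubmodule := by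
  refine le_antisymm ?_ (Submodule.span_le.2 ?_)
  · refine (Submodule.map_mono (isGarnir_polytabloid.tailSpan_succ_le hα h)).trans ?_
    rw [Submodule.map_sup, sup_le_iff, Submodule.map_le_iff_le_comap,
      Submodule.map_le_iff_le_comap]
    constructor <;> refine Submodule.span_le.2 ?_
    · rintro _ ⟨T, hT, rfl⟩
      simp only [SetLike.mem_coe, Submodule.mem_comap]
      rw [restrictMap_polytabloid_eq_zero h hT]
      exact Submodule.zero_mem _
    · rintro _ ⟨T, rfl⟩
      simp only [SetLike.mem_coe, Submodule.mem_comap]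
      rw [restrictMap_polytabloid_extend]
      exact Submodule.subset_span ⟨T, rfl⟩
  · rintro _ ⟨T, rfl⟩
    refine ⟨(T.extend h).polytabloid, mem_tailSpan _ ?_, restrictMap_polytabloid_extend h T⟩
    rw [Tableau.col_extend_last, addBox_apply h, if_neg (by omega), add_zero]
    exact hμ (Nat.le_succ r)

/-- The presentation of `S^μ` provides a map back to the quotient by step `r` that undoes the
deletion, so nothing outside step `r` is killed. -/
theorem spechtTail_succ_inf_ker {α μ : ℕ →₀ ℕ} {m r : ℕ} (hα : Antitone α)
    (h : μ + Finsupp.single r 1 = α) (hμ : Antitone μ) :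
    spechtTail α m (r + 1) ⊓ LinearMap.ker (restrictMap h) = spechtTail α m r := by
  apply le_antisymm
  · rintro v ⟨hv, hv0⟩
    obtain ⟨f, hf⟩ := (isGarnir_polytabloid.extend h).exists_linearMap (n := m) hμ
    have := isGarnir_polytabloid.map_restrictMap hα h hf (L := LinearMap.id) (fun T => rfl) hv
    rw [LinearMap.id_apply, LinearMap.mem_ker.1 hv0, map_zero, eq_comm, Submodule.mkQ_apply,
      Submodule.Quotient.mk_eq_zero] at this
    exact this
  · refine le_inf (tailSpan_mono hα _ (Nat.le_succ r)) (Submodule.span_le.2 ?_)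
    rintro _ ⟨T, hT, rfl⟩
    exact restrictMap_polytabloid_eq_zero h hT

/-- The branching rule for the characters of the symmetric groups. -/
theorem zeta_succPerm {α : ℕ →₀ ℕ} {m : ℕ} (hα : Antitone α) (σ : Perm (Fin m)) :
    zeta α (m + 1) (succPerm σ) =
      ∑ i ∈ (Finset.range (len α)).filter (fun i => α (i + 1) < α i),
        zeta (α - Finsupp.single i 1) m σ := by
  have key : ∀ r, LinearMap.trace ℂ (spechtTail α m r)
      ((permModule α (m + 1) (succPerm σ)).restrict (spechtTail_invariant α r σ)) =
      ∑ i ∈ (Finset.range r).filter (fun i => α (i + 1) < α i),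
        zeta (α - Finsupp.single i 1) m σ := by
    intro r
    induction r with
    | zero =>
      have : Subsingleton (spechtTail α m 0) := by
        rw [Submodule.subsingleton_iff_eq_bot]
        exact tailSpan_zero hα _
      rw [Subsingleton.elim (LinearMap.restrict _ _) 0]
      simp
    | succ r ih =>
      rw [Finset.range_add_one, Finset.filter_insert]
      split_ifs with hr
      · have h := sub_single_add hr
        have hμ := antitone_sub_single hα hr
        rw [Finset.sum_insert (by simp), ← ih, add_comm (zeta _ _ _)]
        exact trace_restrict_eq_add _ _
          (fun v hv => (specht (α - Finsupp.single r 1) m).apply_mem_toSubmodule σ hv)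
          (map_spechtTail_succ hα h hμ) (spechtTail_succ_inf_ker hα h hμ)
          (restrictMap_permModule h σ)
      -- Without a corner in row `r`, `α (r + 1) = α r` and the filtration does not move.
      · rw [← ih]
        have hE : spechtTail α m (r + 1) = spechtTail α m r :=
          tailSpan_succ_eq _ ((hα (Nat.le_succ r)).antisymm (not_lt.1 hr))
        exact trace_restrict_congr hE _ _
  rw [← key]
  exact trace_restrict_congr (tailSpan_of_eq_zero (apply_len α) _).symm
    (fun v hv => (specht α (m + 1)).apply_mem_toSubmodule (succPerm σ) hv) _

/-! ### The scalar of the sum of all transpositions -/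

/-- The scalar by which the transposition of `a` and `b`, applied before column antisymmetrization,
acts on the polytabloid: `1` if `a` and `b` are in the same row (or equal), `-1` if they are in the
same column, and `0` otherwise. -/
noncomputable def Tableau.pairWeight {α : ℕ →₀ ℕ} {n : ℕ} (T : Tableau α n) (a b : Fin n) : ℂ :=
  (if T.row a = T.row b then 1 else 0) - (if T.col a = T.col b then 1 else 0) +
    if a = b then 1 else 0

theorem Tableau.pairWeight_comm {α : ℕ →₀ ℕ} {n : ℕ} (T : Tableau α n) (a b : Fin n) :
    T.pairWeight a b = T.pairWeight b a := by
  simp only [pairWeight, eq_comm]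

/-- The cell in the row of `a` and the column of `b` lies in the diagram; let `d` be its entry.
After the swap `b` and `d` share a row, while they share a column of `T`. -/
theorem antisum_swap_eq_zero {α : ℕ →₀ ℕ} {n : ℕ} (hα : Antitone α) (T : Tableau α n)
    {a b : Fin n} (hr : T.row a < T.row b) (hc : T.col a ≠ T.col b) :
    antisum T.colStab (swap a b • T.tabloid) = 0 := by
  obtain ⟨d, hd1, hd2⟩ := T.exists_row_col ((T.col_lt b).trans_le (hα hr.le))
  have hda : d ≠ a := by rintro rfl; exact hc hd2
  have hdb : d ≠ b := by rintro rfl; exact hr.ne' hd1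
  refine antisum_eq_zero hdb (fun π => Tableau.mul_mem_colStab (Tableau.swap_mem_colStab hd2)) ?_
  rw [Tabloid.smul_val, Tabloid.smul_val, swap_inv, swap_apply_right,
    swap_apply_of_ne_of_ne hda hdb]
  exact hd1

theorem antisum_swap {α : ℕ →₀ ℕ} {n : ℕ} (hα : Antitone α) (T : Tableau α n) (a b : Fin n) :
    antisum T.colStab (swap a b • T.tabloid) = T.pairWeight a b • T.polytabloid := by
  rcases eq_or_ne a b with rfl | hab
  · rw [swap_self, ← Perm.one_def, one_smul]
    simp [Tableau.pairWeight, polytabloid_eq_antisum]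
  by_cases hr : T.row a = T.row b
  · have hc : T.col a ≠ T.col b := fun hc => hab (T.ext_row_col hr hc)
    rw [Tabloid.swap_smul hr]
    simp [Tableau.pairWeight, hr, hc, hab, polytabloid_eq_antisum]
  by_cases hc : T.col a = T.col b
  · rw [antisum_smul (fun π => Tableau.mul_mem_colStab (Tableau.swap_mem_colStab hc)),
      sgn_swap hab]
    simp [Tableau.pairWeight, hr, hc, hab, polytabloid_eq_antisum]
  · have : T.pairWeight a b = 0 := by simp [Tableau.pairWeight, hr, hc, hab]
    rw [this, zero_smul]
    rcases lt_or_gt_of_ne hr with hlt | hlt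
    · exact antisum_swap_eq_zero hα T hlt hc
    · rw [swap_comm]
      exact antisum_swap_eq_zero hα T hlt (Ne.symm hc)

/-- The scalar by which the sum of the transpositions, over all ordered pairs of entries, acts. -/
noncomputable def Tableau.totalWeight {α : ℕ →₀ ℕ} {n : ℕ} (T : Tableau α n) : ℂ :=
  ∑ a, ∑ b, T.pairWeight a b

theorem Tableau.totalWeight_eq {α : ℕ →₀ ℕ} {n : ℕ} (T T' : Tableau α n) :
    T.totalWeight = T'.totalWeight := by
  have h : ∀ a b, T.pairWeight a b =
      T'.pairWeight ((T.trans T'.symm) a) ((T.trans T'.symm) b) := by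
    intro a b
    have hr : ∀ x, T'.row ((T.trans T'.symm) x) = T.row x := by simp [row]
    have hc : ∀ x, T'.col ((T.trans T'.symm) x) = T.col x := by simp [col]
    simp only [pairWeight, hr, hc, EmbeddingLike.apply_eq_iff_eq]
  simp only [totalWeight, h]
  rw [Equiv.sum_comp (T.trans T'.symm) fun a => ∑ b, T'.pairWeight a ((T.trans T'.symm) b)]
  exact Finset.sum_congr rfl fun a _ => Equiv.sum_comp (T.trans T'.symm) (T'.pairWeight a)

/-- Conjugation by `π` permutes the transpositions, so their sum passes to the right of each `π` in
the column antisymmetrizer, where `antisum_swap` evaluates it. -/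
theorem sum_swap_polytabloid {α : ℕ →₀ ℕ} {n : ℕ} (hα : Antitone α) (T : Tableau α n) :
    ∑ a, ∑ b, permModule α n (swap a b) T.polytabloid = T.totalWeight • T.polytabloid := by
  have h1 : ∑ a, ∑ b, permModule α n (swap a b) T.polytabloid =
      ∑ π ∈ T.colStab, ∑ a, ∑ b, MonoidAlgebra.single ((swap a b * π) • T.tabloid) (sgn π) := by
    simp only [Tableau.polytabloid, map_sum, Representation.ofMulAction_single, smul_smul]
    rw [Finset.sum_comm' (t' := Finset.univ) (s' := fun _ => Finset.univ) (by simp)]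
    simp only [Finset.sum_comm (s := Finset.univ) (t := T.colStab)]
    rw [Finset.sum_congr rfl fun π _ => Finset.sum_comm]
    rfl
  have h2 : ∀ π : Perm (Fin n),
      ∑ a, ∑ b, MonoidAlgebra.single ((swap a b * π) • T.tabloid) (sgn π) =
      ∑ a, ∑ b, MonoidAlgebra.single ((π * swap a b) • T.tabloid) (sgn π) := by
    intro π
    rw [← Equiv.sum_comp π]
    refine Finset.sum_congr rfl fun a _ => ?_
    rw [← Equiv.sum_comp π]
    exact Finset.sum_congr rfl fun b _ => by rw [mul_swap_eq_swap_mul]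
  rw [h1, Finset.sum_congr rfl fun π _ => h2 π, Finset.sum_comm]
  simp only [Finset.sum_comm (s := T.colStab) (t := Finset.univ), mul_smul,
    Tableau.totalWeight, Finset.sum_smul, ← antisum_swap hα]
  rfl

theorem zeta_of_isEmpty {α : ℕ →₀ ℕ} {n : ℕ} (h : IsEmpty (Tableau α n)) (g : Perm (Fin n)) :
    zeta α n g = 0 := by
  have : Subsingleton (specht α n).toSubmodule := by
    rw [Submodule.subsingleton_iff_eq_bot]
    change Submodule.span ℂ (Set.range _) = ⊥
    rw [Set.range_eq_empty, Submodule.span_empty]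
  rw [zeta, Representation.character, Subsingleton.elim ((specht α n).toRepresentation g) 0,
    map_zero]

theorem sum_zeta_swap_mul {α : ℕ →₀ ℕ} {n : ℕ} (hα : Antitone α) (T : Tableau α n)
    (g : Perm (Fin n)) :
    ∑ a, ∑ b, zeta α n (swap a b * g) = T.totalWeight * zeta α n g := by
  have h : ∑ a, ∑ b, (specht α n).toRepresentation (swap a b) = T.totalWeight • 1 := by
    have hle : (specht α n).toSubmodule ≤ LinearMap.eqLocus
        (∑ a, ∑ b, permModule α n (swap a b)) (T.totalWeight • LinearMap.id) := by
      refine Submodule.span_le.2 ?_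
      rintro _ ⟨T', rfl⟩
      simp [LinearMap.mem_eqLocus, LinearMap.sum_apply, sum_swap_polytabloid hα,
        T.totalWeight_eq T']
    refine LinearMap.ext fun ⟨v, hv⟩ => Subtype.ext ?_
    have := hle hv
    simp only [LinearMap.mem_eqLocus, LinearMap.sum_apply] at this
    simp only [LinearMap.sum_apply, Submodule.coe_sum]
    exact this
  simp only [zeta, Representation.character, map_mul, ← map_sum, ← Finset.sum_mul]
  rw [h, smul_mul_assoc, one_mul, map_smul, smul_eq_mul]

theorem Tableau.card_row {α : ℕ →₀ ℕ} {n : ℕ} (T : Tableau α n) (r : ℕ) :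
    (Finset.univ.filter (r = T.row ·)).card = α r := by
  simp only [eq_comm (a := r)]
  exact T.tabloid.2 r

theorem Tableau.card_col_corner {μ : ℕ →₀ ℕ} {m r : ℕ} (hμ : Antitone μ)
    (hr : ∀ i < r, μ r < μ i) (T : Tableau μ m) :
    (Finset.univ.filter (μ r = T.col ·)).card = r := by
  simp only [eq_comm (a := μ r)]
  cases r with
  | zero =>
    rw [Finset.card_eq_zero, Finset.filter_eq_empty_iff]
    intro x _ hx
    have h1 := T.col_lt x
    have h2 := hμ (Nat.zero_le (T.row x))
    omega
  | succ r => exact T.card_col hμ le_rfl (hr r (Nat.lt_succ_self r))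

/-- The new entry shares its row with `μ r` others and its column with `r` others. Ordered pairs
count these twice, and the pair of the new entry with itself adds `1`. -/
theorem Tableau.totalWeight_extend {α μ : ℕ →₀ ℕ} {m r : ℕ} (h : μ + Finsupp.single r 1 = α)
    (hα : Antitone α) (hμ : Antitone μ) (T : Tableau μ m) :
    (T.extend h).totalWeight = T.totalWeight + 2 * ((μ r : ℂ) - r) + 1 := by
  have hr : ∀ i < r, μ r < μ i := by
    intro i hi
    have h1 := hα hi.le
    rw [addBox_self h, addBox_apply h, if_neg hi.ne'] at h1
    omega
  have hcc : ∀ a b : Fin m, (T.extend h).pairWeight a.castSucc b.castSucc = T.pairWeight a b := by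
    simp [pairWeight]
  have hll : (T.extend h).pairWeight (Fin.last m) (Fin.last m) = 1 := by simp [pairWeight]
  have hlc : ∑ b : Fin m, (T.extend h).pairWeight (Fin.last m) b.castSucc = (μ r : ℂ) - r := by
    simp only [pairWeight, row_extend_last, row_extend_castSucc, col_extend_last,
      col_extend_castSucc, (Fin.castSucc_ne_last _).symm, if_false, add_zero,
      Finset.sum_sub_distrib, Finset.sum_boole, T.card_row, T.card_col_corner hμ hr]
  rw [totalWeight, Fin.sum_univ_castSucc]
  simp only [Fin.sum_univ_castSucc, hcc, hll, hlc, Finset.sum_add_distrib,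
    pairWeight_comm _ (Fin.castSucc _) (Fin.last m)]
  rw [← totalWeight]
  ring

/-! ### The Jucys–Murphy element -/

theorem succPerm_swap {m : ℕ} (a b : Fin m) :
    succPerm (swap a b) = swap a.castSucc b.castSucc := by
  ext x
  induction x using Fin.lastCases with
  | last =>
    rw [swap_apply_of_ne_of_ne (Fin.castSucc_ne_last _).symm (Fin.castSucc_ne_last _).symm,
      succPerm_last]
  | cast x =>
    rw [succPerm_castSucc, swap_apply_def, swap_apply_def]
    simp only [Fin.castSucc_inj]
    split_ifs <;> rfl

/-- The Jucys–Murphy element acts on the constituents of the restriction by the contents. -/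
theorem sum_zeta_swap_last {α : ℕ →₀ ℕ} {m : ℕ} (hα : Antitone α) (σ : Perm (Fin m)) :
    ∑ k : Fin m, zeta α (m + 1) (swap (Fin.last m) k.castSucc * succPerm σ) =
      ∑ i ∈ (Finset.range (len α)).filter (fun i => α (i + 1) < α i),
        ((α i : ℂ) - ((i : ℂ) + 1)) * zeta (α - Finsupp.single i 1) m σ := by
  rcases isEmpty_or_nonempty (Tableau α (m + 1)) with he | ⟨⟨T⟩⟩
  · rw [Finset.sum_eq_zero fun k _ => zeta_of_isEmpty he _, eq_comm]
    refine Finset.sum_eq_zero fun i hi => ?_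
    have h := sub_single_add (Finset.mem_filter.1 hi).2
    rw [zeta_of_isEmpty ⟨fun T => he.false (T.extend h)⟩, mul_zero]
  have hswap : ∀ a b : Fin m, swap a.castSucc b.castSucc * succPerm σ =
      succPerm (swap a b * σ) := by
    intro a b
    rw [succPerm_mul, succPerm_swap]
  -- The ordered pairs split into those within the first `m` elements, the pairs with the last
  -- element counted twice, and one identity. Branching turns the first part into scalars for the
  -- smaller shapes.
  have h1 := sum_zeta_swap_mul hα T (succPerm σ)
  simp only [Fin.sum_univ_castSucc, swap_self, ← Perm.one_def, one_mul, hswap,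
    Finset.sum_add_distrib, swap_comm (Fin.castSucc _) (Fin.last m), zeta_succPerm hα] at h1
  have h2 : ∑ a : Fin m, ∑ b : Fin m,
      ∑ i ∈ (Finset.range (len α)).filter (fun i => α (i + 1) < α i),
        zeta (α - Finsupp.single i 1) m (swap a b * σ) =
      ∑ i ∈ (Finset.range (len α)).filter (fun i => α (i + 1) < α i),
        (T.totalWeight - 2 * ((α i : ℂ) - ((i : ℂ) + 1)) - 1) *
          zeta (α - Finsupp.single i 1) m σ := by
    simp only [Finset.sum_comm (s := Finset.univ)
      (t := (Finset.range (len α)).filter (fun i => α (i + 1) < α i))]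
    refine Finset.sum_congr rfl fun i hi => ?_
    have hlt := (Finset.mem_filter.1 hi).2
    have h := sub_single_add hlt
    have hμ := antitone_sub_single hα hlt
    rcases isEmpty_or_nonempty (Tableau (α - Finsupp.single i 1) m) with he | ⟨⟨T'⟩⟩
    · simp only [zeta_of_isEmpty he, Finset.sum_const_zero, mul_zero]
    · rw [sum_zeta_swap_mul hμ T', T.totalWeight_eq (T'.extend h),
        T'.totalWeight_extend h hα hμ, addBox_self h]
      push_cast
      ring
  rw [h2] at h1
  simp only [sub_mul, one_mul, mul_assoc, Finset.sum_sub_distrib, ← Finset.mul_sum] at h1 ⊢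
  linear_combination h1 / 2

/-! ### Inserting a new element into a cycle -/

theorem disjoint_formPerm {ι : Type*} [DecidableEq ι] {l l' : List ι} (h : l.Disjoint l') :
    Perm.Disjoint l.formPerm l'.formPerm := by
  intro x
  by_cases hx : x ∈ l
  · exact Or.inr (List.formPerm_apply_of_notMem (h hx))
  · exact Or.inl (List.formPerm_apply_of_notMem hx)

/-- The product of the cycles given by a list of lists. -/
def cycleProd {ι : Type*} [DecidableEq ι] (L : List (List ι)) : Perm ι :=
  (L.map List.formPerm).prod

theorem cycleProd_cons {ι : Type*} [DecidableEq ι] (l : List ι) (L : List (List ι)) :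
    cycleProd (l :: L) = l.formPerm * cycleProd L := by
  simp [cycleProd]

theorem cycleType_formPerm_of_nodup {ι : Type*} [DecidableEq ι] [Fintype ι] {l : List ι}
    (hl : l.Nodup) :
    l.formPerm.cycleType = if 2 ≤ l.length then {l.length} else 0 := by
  split_ifs with h
  · rw [(List.isCycle_formPerm hl h).cycleType, List.support_formPerm_of_nodup l hl,
      List.toFinset_card_of_nodup hl]
    rintro x rfl
    simp at h
  · rw [Perm.cycleType_eq_zero, List.formPerm_eq_one_iff _ hl]
    omega

theorem cycleType_cycleProd {ι : Type*} [DecidableEq ι] [Fintype ι] {L : List (List ι)}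
    (hL : L.flatten.Nodup) :
    (cycleProd L).cycleType = Multiset.filter (2 ≤ ·) (L.map List.length : List ℕ) := by
  induction L with
  | nil => simp [cycleProd]
  | cons l L ih =>
    rw [List.flatten_cons, List.nodup_append'] at hL
    obtain ⟨h1, h2, h3⟩ := hL
    have hd : Perm.Disjoint l.formPerm (cycleProd L) := by
      refine Perm.disjoint_prod_right _ fun g hg => ?_
      obtain ⟨l', hl', rfl⟩ := List.mem_map.1 hg
      exact disjoint_formPerm fun x hx hx' => h3 hx (List.mem_flatten.2 ⟨l', hl', hx'⟩)
    rw [cycleProd_cons, hd.cycleType_mul, cycleType_formPerm_of_nodup h1, ih h2, List.map_cons,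
      ← Multiset.cons_coe, Multiset.filter_cons]

/-- Multiplying a product of disjoint cycles by a transposition that moves a new element `n`
inserts `n` into one of the cycles. -/
theorem exists_swap_mul_cycleProd {ι : Type*} [DecidableEq ι] {n k : ι} :
    ∀ (L : List (List ι)) (j : ℕ) (hj : j < L.length), k ∈ L[j] → L.flatten.Nodup →
      n ∉ L.flatten → ∃ L' : List (List ι), cycleProd L' = swap n k * cycleProd L ∧
        L'.flatten.Nodup ∧ (∀ x, x ∈ L'.flatten ↔ x = n ∨ x ∈ L.flatten) ∧
        L'.map List.length = (L.map List.length).modify j (· + 1) := by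
  intro L
  induction L with
  | nil => intro j hj; simp at hj
  | cons l L ih =>
    intro j hj hk hL hn
    rw [List.flatten_cons, List.nodup_append'] at hL
    rw [List.flatten_cons, List.mem_append, not_or] at hn
    obtain ⟨h1, h2, h3⟩ := hL
    cases j with
    | zero =>
      rw [List.getElem_cons_zero] at hk
      obtain ⟨s, t, rfl⟩ := List.append_of_mem hk
      -- A cycle may be written starting at `k`; then the product with `swap n k` is by definition
      -- the cycle with `n` put in front.
      have hrot : (s ++ k :: t) ~r (k :: t ++ s) := List.isRotated_append
      have hmem : ∀ x, x ∈ k :: t ++ s ↔ x ∈ s ++ k :: t := fun x => hrot.perm.mem_iff.symm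
      have hnd : (k :: t ++ s).Nodup := hrot.nodup_iff.1 h1
      refine ⟨(n :: (k :: t ++ s)) :: L, ?_, ?_, ?_, ?_⟩
      · rw [cycleProd_cons, cycleProd_cons, List.formPerm_eq_of_isRotated h1 hrot, ← mul_assoc]
        rfl
      · rw [List.flatten_cons, List.nodup_append', List.nodup_cons, hmem]
        refine ⟨⟨hn.1, hnd⟩, h2, fun x hx hx' => ?_⟩
        rcases List.mem_cons.1 hx with rfl | hx
        · exact hn.2 hx'
        · exact h3 ((hmem x).1 hx) hx'
      · intro x
        rw [List.flatten_cons, List.flatten_cons, List.mem_append, List.mem_append,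
          List.mem_cons, hmem, or_assoc]
      · simp
        omega
    | succ j =>
      have hj' : j < L.length := by simpa using hj
      rw [List.getElem_cons_succ] at hk
      obtain ⟨L', hL1, hL2, hL3, hL4⟩ := ih j hj' hk h2 hn.2
      have hkL : k ∈ L.flatten := List.mem_flatten.2 ⟨_, List.getElem_mem hj', hk⟩
      refine ⟨l :: L', ?_, ?_, ?_, ?_⟩
      · have hc : Commute l.formPerm (swap n k) := by
          refine Perm.Disjoint.commute fun x => ?_
          by_cases hx : x ∈ l
          · right
            refine swap_apply_of_ne_of_ne ?_ ?_
            · rintro rfl; exact hn.1 hx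
            · rintro rfl; exact h3 hx hkL
          · exact Or.inl (List.formPerm_apply_of_notMem hx)
        rw [cycleProd_cons, cycleProd_cons, hL1, ← mul_assoc, hc.eq, mul_assoc]
      · rw [List.flatten_cons, List.nodup_append']
        refine ⟨h1, hL2, fun x hx hx' => ?_⟩
        rcases (hL3 x).1 hx' with rfl | hx'
        · exact hn.1 hx
        · exact h3 hx hx'
      · intro x
        rw [List.flatten_cons, List.flatten_cons, List.mem_append, List.mem_append, hL3]
        tauto
      · simp [hL4]

theorem succPerm_one {m : ℕ} : succPerm (1 : Perm (Fin m)) = 1 := by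
  ext x
  induction x using Fin.lastCases <;> simp

theorem formPerm_map_castSucc {m : ℕ} : ∀ l : List (Fin m),
    (l.map Fin.castSucc).formPerm = succPerm l.formPerm
  | [] => succPerm_one.symm
  | [x] => succPerm_one.symm
  | x :: y :: l => by
    rw [List.formPerm_cons_cons, succPerm_mul, succPerm_swap, ← formPerm_map_castSucc (y :: l)]
    rfl

theorem cycleProd_map_castSucc {m : ℕ} (L : List (List (Fin m))) :
    cycleProd (L.map (List.map Fin.castSucc)) = succPerm (cycleProd L) := by
  induction L with
  | nil => exact succPerm_one.symm
  | cons l L ih =>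
    rw [List.map_cons, cycleProd_cons, cycleProd_cons, succPerm_mul, ih, formPerm_map_castSucc]

/-! ### The blocks of `σ_β` and the right-hand side -/

theorem rowStart_succ (β : ℕ →₀ ℕ) (j : ℕ) : rowStart β (j + 1) = rowStart β j + β j :=
  Finset.sum_range_succ _ _

theorem rowStart_mono (β : ℕ →₀ ℕ) : Monotone (rowStart β) :=
  monotone_nat_of_le_succ fun j => by rw [rowStart_succ]; omega

/-- The `j`-th of the consecutive blocks of sizes `β_1, β_2, …`. -/
def block (β : ℕ →₀ ℕ) (j : ℕ) : List (Fin β.degree) :=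
  (List.finRange (β j)).map fun i : Fin (β j) =>
    (⟨rowStart β j + i, rowStart_add_lt β j i i.2⟩ : Fin β.degree)

/-- The consecutive blocks of sizes `β_1, β_2, …`. -/
noncomputable def blocks (β : ℕ →₀ ℕ) : List (List (Fin β.degree)) :=
  (List.range (len β)).map (block β)

theorem stdPerm_eq_cycleProd (β : ℕ →₀ ℕ) : stdPerm β = cycleProd (blocks β) := by
  rw [stdPerm, cycleProd, blocks, List.map_map]
  rfl

@[simp] theorem length_block (β : ℕ →₀ ℕ) (j : ℕ) : (block β j).length = β j := by
  simp [block]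

theorem map_length_blocks (β : ℕ →₀ ℕ) :
    (blocks β).map List.length = (List.range (len β)).map β := by
  simp [blocks, Function.comp_def]

theorem mem_block {β : ℕ →₀ ℕ} {j : ℕ} {x : Fin β.degree} (h : x ∈ block β j) :
    rowStart β j ≤ x ∧ (x : ℕ) < rowStart β (j + 1) := by
  obtain ⟨i, _, rfl⟩ := List.mem_map.1 h
  rw [rowStart_succ]
  have := i.2
  simp only
  omega

theorem nodup_blocks (β : ℕ →₀ ℕ) : (blocks β).flatten.Nodup := by
  rw [List.nodup_flatten]
  constructor
  · intro l hl
    obtain ⟨j, _, rfl⟩ := List.mem_map.1 hl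
    refine (List.nodup_finRange _).map fun a b hab => ?_
    simpa [Fin.ext_iff] using hab
  · rw [blocks, List.pairwise_map]
    refine List.pairwise_lt_range.imp fun {i j} hij x hx hx' => ?_
    have h1 := mem_block hx
    have h2 := mem_block hx'
    have h3 := rowStart_mono β (Nat.succ_le_of_lt hij)
    simp only [Nat.succ_eq_add_one] at h3
    omega

theorem sum_range_len (β : ℕ →₀ ℕ) : ∑ j ∈ Finset.range (len β), β j = β.degree := by
  rw [Finsupp.degree_apply, eq_comm]
  refine Finset.sum_subset (fun j hj => ?_) (by simp)
  rw [Finset.mem_range]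
  by_contra h
  exact Finsupp.mem_support_iff.1 hj (len_le_iff.1 (not_lt.1 h) j le_rfl)

theorem toFinset_blocks (β : ℕ →₀ ℕ) : (blocks β).flatten.toFinset = Finset.univ := by
  rw [← Finset.card_eq_iff_eq_univ, List.toFinset_card_of_nodup (nodup_blocks β),
    List.length_flatten, map_length_blocks, Fintype.card_fin, ← sum_range_len β]
  rfl

theorem len_add_single {β : ℕ →₀ ℕ} {j : ℕ} (hj : j < len β) :
    len (β + Finsupp.single j 1) = len β := by
  apply le_antisymm
  · rw [len_le_iff]
    intro k hk
    rw [Finsupp.add_apply, len_le_iff.1 le_rfl k hk, Finsupp.single_eq_of_ne (by omega), add_zero]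
  · rw [len_le_iff]
    intro k hk
    have := len_le_iff.1 (le_refl (len (β + Finsupp.single j 1))) k hk
    rw [Finsupp.add_apply] at this
    omega

theorem zetaVal_eq_of_cycleType {α γ : ℕ →₀ ℕ} {N : ℕ} (h : γ.degree = N) {g : Perm (Fin N)}
    (hg : g.cycleType = Multiset.filter (2 ≤ ·) ((List.range (len γ)).map γ : List ℕ)) :
    zetaVal α γ = zeta α N g := by
  subst h
  have hc : IsConj (stdPerm γ) g := by
    rw [Perm.isConj_iff_cycleType_eq, hg, stdPerm_eq_cycleProd,
      cycleType_cycleProd (nodup_blocks γ), map_length_blocks]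
  obtain ⟨c, rfl⟩ := isConj_iff.1 hc
  rw [zetaVal, zeta, Representation.char_conj]

/-- The product is `σ_β` with the new element inserted into cycle `j`. It has the cycle type of
`σ_{β+ε_j}`, hence is conjugate to it, and characters are class functions. -/
theorem zeta_swap_mul_succPerm {α β : ℕ →₀ ℕ} {j : ℕ} (hj : j < len β) {k : Fin β.degree}
    (hk : k ∈ block β j) :
    zeta α (β.degree + 1) (swap (Fin.last _) k.castSucc * succPerm (stdPerm β)) =
      zetaVal α (β + Finsupp.single j 1) := by
  have hfl : ((blocks β).map (List.map Fin.castSucc)).flatten =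
      (blocks β).flatten.map Fin.castSucc := List.map_flatten.symm
  obtain ⟨L', h1, h2, -, h4⟩ := exists_swap_mul_cycleProd (n := Fin.last β.degree)
    (k := k.castSucc) ((blocks β).map (List.map Fin.castSucc)) j (by simpa [blocks] using hj)
    (by simpa [blocks] using hk)
    (by rw [hfl]; exact (nodup_blocks β).map (Fin.castSucc_injective _))
    (by rw [hfl]; simp [Fin.castSucc_ne_last])
  rw [cycleProd_map_castSucc, ← stdPerm_eq_cycleProd] at h1
  rw [← h1, eq_comm]
  refine zetaVal_eq_of_cycleType (by simp) ?_
  rw [cycleType_cycleProd h2, h4]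
  congr 2
  rw [len_add_single hj]
  have : (((blocks β).map (List.map Fin.castSucc)).map List.length) =
      (List.range (len β)).map β := by
    rw [← map_length_blocks, List.map_map]
    congr 1
    funext l
    simp
  rw [this]
  refine List.ext_getElem (by simp) fun i hi hi' => ?_
  simp only [List.getElem_modify, List.getElem_map, List.getElem_range, Finsupp.add_apply,
    Finsupp.single_apply]
  split_ifs <;> rfl

/-- The blocks partition the points, and all `β j` points of block `j` give the same value. -/
theorem sum_zeta_swap_eq {α β : ℕ →₀ ℕ} :
    ∑ k : Fin β.degree, zeta α (β.degree + 1)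
        (swap (Fin.last _) k.castSucc * succPerm (stdPerm β)) =
      ∑ j ∈ Finset.range (len β), (β j : ℂ) * zetaVal α (β + Finsupp.single j 1) := by
  rw [← toFinset_blocks, List.sum_toFinset _ (nodup_blocks β), List.map_flatten, List.sum_flatten,
    blocks, List.map_map, List.map_map]
  change (List.map _ (List.range (len β))).sum = ((List.range (len β)).map _).sum
  congr 1
  refine List.map_congr_left fun j hj => ?_
  simp only [Function.comp_apply]
  rw [List.map_congr_left fun k hk => zeta_swap_mul_succPerm (List.mem_range.1 hj) hk]
  simp

end SymChar

theorem theorem3p5 (n : ℕ) (hn : 0 < n) (α : ℕ →₀ ℕ) (hα : SymChar.IsPartition α n)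
    (β : ℕ →₀ ℕ) (hβ : β.degree = n - 1) :
    ∑ i ∈ (Finset.range (SymChar.len α)).filter (fun i => α (i + 1) < α i),
        ((α i : ℂ) - ((i : ℂ) + 1)) * SymChar.zetaVal (α - Finsupp.single i 1) β =
      ∑ j ∈ Finset.range (SymChar.len β),
        (β j : ℂ) * SymChar.zetaVal α (β + Finsupp.single j 1) := by
  rw [← SymChar.sum_zeta_swap_eq, SymChar.sum_zeta_swap_last (SymChar.antitone_of_le hα.2)]
  rfl
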